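/- Let $\mathcal X,\mathcal Y,\hat{\mathcal X}$ be finite sets, let $(X_i,Y_i)$, $i\ge 1$, be i.i.d. with law $P_{X,Y}$ on $\mathcal X\times\mathcal Y$, and let $d:\mathcal X\times\hat{\mathcal X}\to[D_{\min},D_{\max}]$ be a distortion measure such that for every $x$ with $P_X(x)>0$ there is $\hat x$ with $d(x,\hat x)=D_{\min}$. Put $d(x^n,\hat x^n)=\frac1n\sum_{i=1}^n d(x_i,\hat x_i)$. Let $f:[D_{\min},D_{\max}]\to[0,\infty)$ be non-decreasing and left-continuous, and let $t>f(D_{\min})$. Define $$L^{(M)}(n,t,f)=\min \tfrac1n I(Y^n;\hat X^n),\qquad L(D)=\min_{P_{\hat X|X,Y}:\ \mathbb E[d(X,\hat X)]\le D} I(Y;\hat X)\quad(D\ge D_{\min}),$$ where the first minimum is over the stationary memoryless mechanisms $P_{\hat X^n|X^n,Y^n}=(P_{\hat X|X,Y})^n$ with $\mathbb E[f(d(X^n,\hat X^n))]\le t$, and let $L^{(M)}(t,f)=\lim_{n\to\infty}L^{(M)}(n,t,f)$. Let $$f_l^{-1}(t)=\sup\{D\in[D_{\min},D_{\max}]: f(D)<t\},\qquad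 f_u^{-1}(t)=\sup\{D\in[D_{\min},D_{\max}]: f(D)\le t\},$$ let $\mathcal T_f=\{t>f(D_{\min}): f_l^{-1}(t)\ne f_u^{-1}(t)\}$, and for $t\notin\mathcal T_f$ write $f^{-1}(t)=f_l^{-1}(t)=f_u^{-1}(t)$. For a distribution $P_{X,\hat X}$ on $\mathcal X\times\hat{\mathcal X}$ and a real $c$ let $$R^l(P_{X,\hat X},c)=\min_{Q_{X,\hat X}:\ \mathbb E_Q[d(X,\hat X)]\le c} D_{\mathrm{KL}}(Q_{X,\hat X}\|P_{X,\hat X}),\qquad R^u(P_{X,\hat X},c)=\min_{Q_{X,\hat X}:\ \mathbb E_Q[d(X,\hat X)]\ge c} D_{\mathrm{KL}}(Q_{X,\hat X}\|P_{X,\hat X}),$$ with value $+\infty$ if no $Q$ is admissible. Then the minima that define $L^{(M)}(n,t,f)$ and $L(D)$ exist, the limit $L^{(M)}(t,f)$ exists, and the following hold. (i) If $t\notin\mathcal T_f$, then $L^{(M)}(t,f)=L(f^{-1}(t))$. (ii) If $t\in\mathcal T_f$ and $f_u^{-1}(t)\ne d(x,\hat x)$ for all $\hat x$ and all $x$ with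 $P_X(x)>0$, then $$L^{(M)}(t,f)=\min\{I(Y;\hat X):\ P_{\hat X|X,Y}\text{ with } R^l(P_{X,\hat X},f_l^{-1}(t))\le R^u(P_{X,\hat X},f_u^{-1}(t))\},$$ and if in addition $L(f_u^{-1}(t))>0$, then the minimum is unchanged when the constraint is replaced by $R^l(P_{X,\hat X},f_l^{-1}(t))= R^u(P_{X,\hat X},f_u^{-1}(t))$. (iii) For every $t\in\mathcal T_f$, $L^{(M)}(t,f)$ is the minimum of $I(Y;\hat X)$ over all $P_{\hat X|X,Y}$ such that $R^l(P_{X,\hat X},f_l^{-1}(t))\le R^u(P_{X,\hat X},c)$ for every $c>f_u^{-1}(t)$. -/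

import Mathlib

open Set Filter Topology
open scoped ENNReal

noncomputable section

namespace Leakage

/-- Expectation of `g` under the (finitely supported) distribution `J`. -/
def expect {A : Type*} [Fintype A] (J : A → ℝ) (g : A → ℝ) : ℝ :=
  ∑ a, J a * g a

/-- Mutual information (in nats) between the two coordinates of a joint distribution `J`.
Terms with `J (a, b) = 0` vanish, which is the convention `0 log 0 = 0`. -/
def mutualInfo {A B : Type*} [Fintype A] [Fintype B] (J : A × B → ℝ) : ℝ :=
  ∑ a, ∑ b, J (a, b) * Real.log (J (a, b) / ((∑ b', J (a, b')) * ∑ a', J (a', b)))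

open Classical in
/-- Kullback-Leibler divergence (in nats) of two distributions on a finite alphabet; it is `∞`
when `Q` is not absolutely continuous with respect to `P`. -/
def kl {A : Type*} [Fintype A] (Q P : A → ℝ) : ℝ≥0∞ :=
  if ∀ a, P a = 0 → Q a = 0 then ENNReal.ofReal (∑ a, Q a * Real.log (Q a / P a)) else ⊤

/-- A random mechanism `P_{X̂|X,Y}`: a conditional distribution on `C` given `(x, y)`. -/
def IsMechanism {A B C : Type*} [Fintype C] (W : A × B → C → ℝ) : Prop :=
  ∀ p, W p ∈ stdSimplex ℝ C

/-- Joint law `P_{X,X̂}` of the data `X` and the output, for source `P` and mechanism `W`. -/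
def jointX {A B C : Type*} [Fintype B] (P : A × B → ℝ) (W : A × B → C → ℝ) : A × C → ℝ :=
  fun p => ∑ y, P (p.1, y) * W (p.1, y) p.2

/-- Joint law `P_{Y,X̂}` of the private data `Y` and the output. -/
def jointY {A B C : Type*} [Fintype A] (P : A × B → ℝ) (W : A × B → C → ℝ) : B × C → ℝ :=
  fun p => ∑ x, P (x, p.1) * W (x, p.1) p.2

/-- Law of `(X^n, Y^n)`, with `(X_i, Y_i)` i.i.d. of law `P`. -/
def powSource {X Y : Type*} (P : X × Y → ℝ) (n : ℕ) : (Fin n → X) × (Fin n → Y) → ℝ :=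
  fun p => ∏ i, P (p.1 i, p.2 i)

/-- The stationary memoryless `n`-letter mechanism built from the single-letter mechanism `W`. -/
def powMechanism {X Y Xh : Type*} (W : X × Y → Xh → ℝ) (n : ℕ) :
    (Fin n → X) × (Fin n → Y) → (Fin n → Xh) → ℝ :=
  fun p z => ∏ i, W (p.1 i, p.2 i) (z i)

/-- Distortion between sequences: the average of the single-letter distortions. -/
def seqDist {X Xh : Type*} (d : X → Xh → ℝ) {n : ℕ} (x : Fin n → X) (z : Fin n → Xh) : ℝ :=
  (1 / (n : ℝ)) * ∑ i, d (x i) (z i)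

section
variable {X Y Xh : Type*} [Fintype X] [Fintype Y] [Fintype Xh]

/-- Normalized leakages `I(Y^n; X̂^n) / n` of the stationary memoryless mechanisms that satisfy
`E[f(d(X^n, X̂^n))] ≤ t`. -/
def memorylessLeakages (P : X × Y → ℝ) (d : X → Xh → ℝ) (f : ℝ → ℝ) (t : ℝ) (n : ℕ) : Set ℝ :=
  {r | ∃ W : X × Y → Xh → ℝ, IsMechanism W ∧
    expect (jointX (powSource P n) (powMechanism W n)) (fun p => f (seqDist d p.1 p.2)) ≤ t ∧
    r = (1 / (n : ℝ)) * mutualInfo (jointY (powSource P n) (powMechanism W n))}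

/-- The minimal leakage `L^{(M)}(n, t, f)` under stationary memoryless mechanisms. -/
def LM (P : X × Y → ℝ) (d : X → Xh → ℝ) (f : ℝ → ℝ) (t : ℝ) (n : ℕ) : ℝ :=
  sInf (memorylessLeakages P d f t n)

/-- Leakages `I(Y; X̂)` of the single-letter mechanisms with `E[d(X, X̂)] ≤ D`. -/
def singleLetterLeakages (P : X × Y → ℝ) (d : X → Xh → ℝ) (D : ℝ) : Set ℝ :=
  {r | ∃ W : X × Y → Xh → ℝ, IsMechanism W ∧
    expect (jointX P W) (fun p => d p.1 p.2) ≤ D ∧ r = mutualInfo (jointY P W)}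

/-- The single-letter leakage function `L(D)`. -/
def L (P : X × Y → ℝ) (d : X → Xh → ℝ) (D : ℝ) : ℝ :=
  sInf (singleLetterLeakages P d D)

/-- The exponent `R^u(J, c)`: minimal divergence from `J` over `Q` with `E_Q[d] ≥ c`
(`∞` if there is no such `Q`). -/
def Ru (d : X → Xh → ℝ) (J : X × Xh → ℝ) (c : ℝ) : ℝ≥0∞ :=
  ⨅ (Q : X × Xh → ℝ) (_ : Q ∈ stdSimplex ℝ (X × Xh))
    (_ : c ≤ expect Q (fun p => d p.1 p.2)), kl Q J

/-- The exponent `R^l(J, c)`: minimal divergence from `J` over `Q` with `E_Q[d] ≤ c`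
(`∞` if there is no such `Q`). -/
def Rl (d : X → Xh → ℝ) (J : X × Xh → ℝ) (c : ℝ) : ℝ≥0∞ :=
  ⨅ (Q : X × Xh → ℝ) (_ : Q ∈ stdSimplex ℝ (X × Xh))
    (_ : expect Q (fun p => d p.1 p.2) ≤ c), kl Q J

end

/-- The lower inverse `f_l⁻¹(t)` of a cost function on `[Dmin, Dmax]`. -/
def invL (f : ℝ → ℝ) (Dmin Dmax t : ℝ) : ℝ := sSup {D | D ∈ Icc Dmin Dmax ∧ f D < t}

/-- The upper inverse `f_u⁻¹(t)` of a cost function on `[Dmin, Dmax]`. -/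
def invU (f : ℝ → ℝ) (Dmin Dmax t : ℝ) : ℝ := sSup {D | D ∈ Icc Dmin Dmax ∧ f D ≤ t}

/-- The set `T_f` of thresholds at which the two inverses differ. -/
def flatLevels (f : ℝ → ℝ) (Dmin Dmax : ℝ) : Set ℝ :=
  {t | f Dmin < t ∧ invL f Dmin Dmax t ≠ invU f Dmin Dmax t}

end Leakage

end

/-! Information is additive over the letters of a memoryless mechanism, so the normalized leakage is
the single-letter `I(Y; X̂)` for every block length. The block length enters only through the cost
constraint, and the task is to find which mechanisms meet it as `n → ∞`.

Write `Dl`, `Du` for the lower and upper inverses. The cost is below `t` left of `Dl`, equal to `t`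
strictly between `Dl` and `Du`, and above `t` right of `Du`. The expected cost therefore weighs the
gain from an average distortion below `Dl` against the loss from one above `Du`. If `Dl = Du`, the
law of large numbers decides and the limiting constraint is `E[d] ≤ Dl`. If `Dl < Du`, the cost
being bounded, only the exponents `R^l` and `R^u` of the two events matter. They come from
Chernoff's bound and a change of measure (`eventually_half_exp_le_iidExpect`); `exists_sum_exp_lt`
matches Chernoff exponents with minimal divergences.

A limit of feasible mechanisms satisfies the weak comparison of exponents
(`exp_neg_klReal_le_of_cost_le`). Conversely, a mechanism satisfying it becomes feasible for large
`n` once a little of a mechanism with distortion `Dmin` is mixed in (`eventually_feasible_mix`). By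
compactness of the set of mechanisms and continuity of the information, these two facts give
convergence of the minima (`exists_tendsto_min`).

For the equality form, a minimizer with strict inequality and positive leakage could be mixed with
an independent output of the same law, which lowers the leakage and keeps the constraint
(`exists_mutualInfo_lt_of_Rl_lt_Ru`). -/

namespace Leakage

/-! ### Large deviations of i.i.d. sums. -/

section IidSums
variable {A : Type*} [Fintype A]

/-- Expectation of `F` over sequences with i.i.d. letters of law `J`. -/
noncomputable def iidExpect (J : A → ℝ) (n : ℕ) (F : (Fin n → A) → ℝ) : ℝ :=
  ∑ a : Fin n → A, (∏ i, J (a i)) * F a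

lemma iidExpect_mono {J : A → ℝ} (hJ : ∀ a, 0 ≤ J a) {n : ℕ} {F G : (Fin n → A) → ℝ}
    (h : ∀ a, (∀ i, J (a i) ≠ 0) → F a ≤ G a) : iidExpect J n F ≤ iidExpect J n G := by
  refine Finset.sum_le_sum fun a _ => ?_
  by_cases h0 : ∀ i, J (a i) ≠ 0
  · exact mul_le_mul_of_nonneg_left (h a h0) (Finset.prod_nonneg fun i _ => hJ _)
  · push Not at h0
    obtain ⟨i, hi⟩ := h0
    rw [Finset.prod_eq_zero (f := fun i => J (a i)) (Finset.mem_univ i) hi, zero_mul, zero_mul]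

lemma iidExpect_prod (J g : A → ℝ) (n : ℕ) :
    iidExpect J n (fun a => ∏ i, g (a i)) = (∑ a, J a * g a) ^ n := by
  classical
  have := Finset.prod_univ_sum (fun _ : Fin n => (Finset.univ : Finset A))
    (fun _ a => J a * g a)
  simp only [Finset.prod_const, Finset.card_univ, Fintype.card_fin, Fintype.piFinset_univ] at this
  simp [iidExpect, this, Finset.prod_mul_distrib]

lemma iidExpect_const {J : A → ℝ} (hJ : ∑ a, J a = 1) (n : ℕ) (c : ℝ) :
    iidExpect J n (fun _ => c) = c := by
  have := iidExpect_prod J (fun _ => 1) n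
  simp only [mul_one, hJ, one_pow, Finset.prod_const_one] at this
  simp only [iidExpect, mul_one] at this
  simp [iidExpect, ← Finset.sum_mul, this]

lemma iidExpect_sub (J : A → ℝ) (n : ℕ) (F G : (Fin n → A) → ℝ) :
    iidExpect J n (fun a => F a - G a) = iidExpect J n F - iidExpect J n G := by
  simp [iidExpect, mul_sub, Finset.sum_sub_distrib]

lemma iidExpect_add (J : A → ℝ) (n : ℕ) (F G : (Fin n → A) → ℝ) :
    iidExpect J n (fun a => F a + G a) = iidExpect J n F + iidExpect J n G := by
  simp [iidExpect, mul_add, Finset.sum_add_distrib]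

lemma iidExpect_const_mul (J : A → ℝ) (n : ℕ) (c : ℝ) (F : (Fin n → A) → ℝ) :
    iidExpect J n (fun a => c * F a) = c * iidExpect J n F := by
  simp only [iidExpect, Finset.mul_sum]
  exact Finset.sum_congr rfl fun a _ => by ring

lemma iidExpect_sum {J : A → ℝ} (hJ : ∑ a, J a = 1) (n : ℕ) (h : A → ℝ) :
    iidExpect J n (fun a => ∑ i, h (a i)) = n * ∑ a, J a * h a := by
  classical
  have key : ∀ j : Fin n, ∑ a : Fin n → A, (∏ i, J (a i)) * h (a j) = ∑ a, J a * h a := by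
    intro j
    have := Finset.prod_univ_sum (fun _ : Fin n => (Finset.univ : Finset A))
      (fun i a => J a * if i = j then h a else 1)
    rw [Finset.prod_eq_single j] at this
    · simp only [if_true, Fintype.piFinset_univ, Finset.prod_mul_distrib,
        Finset.prod_ite_eq', Finset.mem_univ] at this
      exact this.symm
    · intro i _ hij
      simp [hij, hJ]
    · simp
  simp only [iidExpect, Finset.mul_sum]
  rw [Finset.sum_comm]
  simp_rw [key]
  simp [Finset.mul_sum]

open Classical in
/-- Chernoff bound. -/
lemma iidExpect_indicator_le_pow {J : A → ℝ} (hJ : ∀ a, 0 ≤ J a) (g : A → ℝ) {s : ℝ}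
    (hs : 0 ≤ s) (n : ℕ) :
    iidExpect J n (fun a => if ∑ i, g (a i) ≤ 0 then 1 else 0) ≤
      (∑ a, J a * Real.exp (-(s * g a))) ^ n := by
  rw [← iidExpect_prod]
  refine iidExpect_mono hJ fun a _ => ?_
  rw [← Real.exp_sum]
  split_ifs with h
  · rw [Finset.sum_neg_distrib, ← Finset.mul_sum]
    exact Real.one_le_exp (by nlinarith)
  · positivity

lemma exists_exp_sum_lt_one {J : A → ℝ} (hJ : J ∈ stdSimplex ℝ A) {g : A → ℝ}
    (hg : 0 < ∑ a, J a * g a) : ∃ s : ℝ, 0 < s ∧ ∑ a, J a * Real.exp (-(s * g a)) < 1 := by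
  obtain ⟨hJ0, hJ1⟩ := hJ
  set G : ℝ := ∑ a, |g a| with hG
  have hgG : ∀ a, |g a| ≤ G := fun a =>
    Finset.single_le_sum (f := fun a => |g a|) (fun _ _ => abs_nonneg _) (Finset.mem_univ a)
  set m := ∑ a, J a * g a with hm
  have hmG : m ≤ G := by
    calc m ≤ ∑ a, J a * G :=
          Finset.sum_le_sum fun a _ =>
            mul_le_mul_of_nonneg_left ((le_abs_self _).trans (hgG a)) (hJ0 a)
      _ = G := by rw [← Finset.sum_mul, hJ1, one_mul]
  have hG0 : 0 < G := hg.trans_le hmG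
  -- From `exp (-x) ≤ 1 - x + x ^ 2` for `|x| ≤ 1`, the sum is at most `1 - s m + s² G²`; this `s`
  -- minimizes that bound.
  refine ⟨m / (2 * G ^ 2), by positivity, ?_⟩
  set s := m / (2 * G ^ 2) with hsdef
  have hs : 0 < s := by positivity
  have hsG : s * G ^ 2 = m / 2 := by rw [hsdef]; field_simp
  have hs1 : s * G ≤ 1 := by
    by_contra! hcon
    nlinarith
  have hterm : ∀ a, J a * Real.exp (-(s * g a)) ≤ J a * (1 + s ^ 2 * G ^ 2) - s * (J a * g a) := by
    intro a
    have hab : |-(s * g a)| ≤ s * G := by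
      rw [abs_neg, abs_mul, abs_of_pos hs]
      exact mul_le_mul_of_nonneg_left (hgG a) hs.le
    have h1 := Real.abs_exp_sub_one_sub_id_le (hab.trans hs1)
    have h2 := (abs_le.1 h1).2
    have h3 : (-(s * g a)) ^ 2 ≤ s ^ 2 * G ^ 2 := by
      rw [← mul_pow, ← sq_abs (-(s * g a))]
      exact pow_le_pow_left₀ (abs_nonneg _) hab 2
    have : Real.exp (-(s * g a)) ≤ 1 + s ^ 2 * G ^ 2 - s * g a := by linarith
    calc _ ≤ J a * (1 + s ^ 2 * G ^ 2 - s * g a) := mul_le_mul_of_nonneg_left this (hJ0 a)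
      _ = _ := by ring
  calc _ ≤ ∑ a, (J a * (1 + s ^ 2 * G ^ 2) - s * (J a * g a)) :=
        Finset.sum_le_sum fun a _ => hterm a
    _ = 1 + s * (s * G ^ 2) - s * m := by
        rw [Finset.sum_sub_distrib, ← Finset.sum_mul, hJ1, ← Finset.mul_sum]; ring
    _ < 1 := by rw [hsG]; nlinarith

open Classical in
/-- Change of measure: under `Q`, the event `E` together with a bound on the log-likelihood ratio
`w` is at most `exp (n K)` times as likely as `E` is under `H`. -/
lemma iidExpect_change_measure {Q H : A → ℝ} (hQ : ∀ a, 0 ≤ Q a) (hH : ∀ a, 0 ≤ H a)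
    {w : A → ℝ} (hw : ∀ a, Q a ≤ Real.exp (w a) * H a) (K : ℝ) (n : ℕ) (E : (Fin n → A) → Prop) :
    iidExpect Q n (fun a => if E a ∧ ∑ i, w (a i) ≤ n * K then 1 else 0) ≤
      Real.exp (n * K) * iidExpect H n (fun a => if E a then 1 else 0) := by
  rw [iidExpect, iidExpect, Finset.mul_sum]
  refine Finset.sum_le_sum fun a _ => ?_
  have hprod : 0 ≤ ∏ i, H (a i) := Finset.prod_nonneg fun i _ => hH _
  by_cases hE : E a
  · by_cases hK : ∑ i, w (a i) ≤ n * K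
    · simp only [hE, hK, and_self, if_true, mul_one]
      calc ∏ i, Q (a i) ≤ ∏ i, (Real.exp (w (a i)) * H (a i)) :=
            Finset.prod_le_prod (fun i _ => hQ _) fun i _ => hw _
        _ = Real.exp (∑ i, w (a i)) * ∏ i, H (a i) := by
            rw [Finset.prod_mul_distrib, Real.exp_sum]
        _ ≤ _ := mul_le_mul_of_nonneg_right (Real.exp_le_exp.2 hK) hprod
    · simp only [hE, hK, and_false, if_false, if_true, mul_one, mul_zero]
      positivity
  · simp [hE]

open Classical in
-- Under `Q` the event and the bound `∑ w ≤ n K` are both typical, and changing measure to `H` costs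
-- at most `exp (n K)`. The threshold on `n` does not depend on `H`, so the bound applies along a
-- varying sequence of laws. The second alternative in `hg` covers a boundary case in which the mean
-- of `g` may vanish.
lemma eventually_half_exp_le_iidExpect {Q : A → ℝ} (hQ : Q ∈ stdSimplex ℝ A) {w g : A → ℝ}
    {K : ℝ} (hK : ∑ a, Q a * w a < K)
    (hg : 0 < ∑ a, Q a * g a ∨ ∀ a, Q a ≠ 0 → 0 ≤ g a) :
    ∀ᶠ n : ℕ in atTop, ∀ H : A → ℝ, (∀ a, 0 ≤ H a) → (∀ a, Q a ≤ Real.exp (w a) * H a) →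
      1 / 2 * Real.exp (-(n * K)) ≤
        iidExpect H n (fun a => if 0 ≤ ∑ i, g (a i) then 1 else 0) := by
  have hQ0 := hQ.1
  have hw : 0 < ∑ a, Q a * (K - w a) := by
    simp only [mul_sub, Finset.sum_sub_distrib, ← Finset.sum_mul, hQ.2]
    linarith
  obtain ⟨s, hs, hs1⟩ := exists_exp_sum_lt_one hQ hw
  have hρ0 : 0 ≤ ∑ a, Q a * Real.exp (-(s * (K - w a))) :=
    Finset.sum_nonneg fun a _ => mul_nonneg (hQ0 a) (Real.exp_nonneg _)
  have hbad : ∃ ρ : ℝ, 0 ≤ ρ ∧ ρ < 1 ∧ ∀ n : ℕ, 0 < n →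
      iidExpect Q n (fun a => if ∑ i, g (a i) < 0 then 1 else 0) ≤ ρ ^ n := by
    rcases hg with hg | hg
    · obtain ⟨r, hr, hr1⟩ := exists_exp_sum_lt_one hQ hg
      refine ⟨_, Finset.sum_nonneg fun a _ => mul_nonneg (hQ0 a) (Real.exp_nonneg _), hr1,
        fun n _ => ?_⟩
      refine le_trans (iidExpect_mono hQ0 fun a _ => ?_) (iidExpect_indicator_le_pow hQ0 g hr.le n)
      by_cases h1 : ∑ i, g (a i) < 0
      · rw [if_pos h1, if_pos h1.le]
      · rw [if_neg h1]; split_ifs <;> norm_num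
    · refine ⟨0, le_rfl, one_pos, fun n hn => ?_⟩
      rw [zero_pow hn.ne']
      refine le_trans (iidExpect_mono (G := fun _ => 0) hQ0 fun a ha => ?_)
        (iidExpect_const hQ.2 n 0).le
      rw [if_neg (not_lt.2 (Finset.sum_nonneg fun i _ => hg _ (ha i)))]
  obtain ⟨ρ, hρ, hρ1, hbad⟩ := hbad
  -- The two exceptional events get probability `1 / 4` each, which leaves the `1 / 2` of the claim.
  have h1 := (tendsto_pow_atTop_nhds_zero_of_lt_one hρ hρ1).eventually_lt_const
    (show (0 : ℝ) < 1 / 4 by norm_num)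
  have h2 := (tendsto_pow_atTop_nhds_zero_of_lt_one hρ0 hs1).eventually_lt_const
    (show (0 : ℝ) < 1 / 4 by norm_num)
  filter_upwards [h1, h2, eventually_gt_atTop 0] with n hn1 hn2 hn H hH hQH
  have hcm := iidExpect_change_measure hQ0 hH hQH K n (fun a => 0 ≤ ∑ i, g (a i))
  have hLLR := iidExpect_indicator_le_pow hQ0 (fun a => K - w a) hs.le n
  have htotal : iidExpect Q n (fun _ => 1) ≤
      iidExpect Q n (fun a => if 0 ≤ ∑ i, g (a i) ∧ ∑ i, w (a i) ≤ n * K then 1 else 0) +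
      iidExpect Q n (fun a => if ∑ i, g (a i) < 0 then 1 else 0) +
      iidExpect Q n (fun a => if ∑ i, (K - w (a i)) ≤ 0 then 1 else 0) := by
    rw [← iidExpect_add, ← iidExpect_add]
    refine iidExpect_mono hQ0 fun a _ => ?_
    have : ∑ i, (K - w (a i)) = n * K - ∑ i, w (a i) := by simp
    rw [this]
    by_cases ha : 0 ≤ ∑ i, g (a i)
    · by_cases hb : ∑ i, w (a i) ≤ n * K
      · simp only [ha, hb, and_self, if_true]; split_ifs <;> norm_num
      · have : (n : ℝ) * K - ∑ i, w (a i) ≤ 0 := by linarith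
        simp only [this, if_true]; split_ifs <;> norm_num
    · have := not_le.1 ha
      simp only [this, if_true]; split_ifs <;> norm_num
  rw [iidExpect_const hQ.2] at htotal
  have hhalf : 1 / 2 ≤ Real.exp (n * K) *
      iidExpect H n (fun a => if 0 ≤ ∑ i, g (a i) then 1 else 0) := by
    have := hbad n hn
    linarith
  rw [Real.exp_neg, ← div_eq_mul_inv, div_le_iff₀ (Real.exp_pos _), mul_comm _ (Real.exp _)]
  exact hhalf

end IidSums

/-! ### Divergence and its duality with exponential moments. -/

section RealDivergence
variable {A : Type*} [Fintype A]

/-- The real-valued Kullback-Leibler sum of two vectors. -/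
noncomputable def klReal (Q J : A → ℝ) : ℝ := ∑ a, Q a * Real.log (Q a / J a)

lemma kl_of_ac {Q J : A → ℝ} (h : ∀ a, J a = 0 → Q a = 0) :
    kl Q J = ENNReal.ofReal (klReal Q J) := by
  simp only [kl, klReal]
  rw [if_pos h]

lemma ac_of_kl_ne_top {Q J : A → ℝ} (h : kl Q J ≠ ⊤) : ∀ a, J a = 0 → Q a = 0 := by
  by_contra h'
  exact h (if_neg h')

lemma klReal_self (J : A → ℝ) : klReal J J = 0 := by
  refine Finset.sum_eq_zero fun a _ => ?_
  by_cases h : J a = 0 <;> simp [h]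

/-- Tangent line bound for `a log (a / b)`. -/
lemma mul_log_div_ge {a b r : ℝ} (ha : 0 ≤ a) (hb : 0 ≤ b) (hab : b = 0 → a = 0) (hr : 0 < r) :
    a * Real.log r + a - r * b ≤ a * Real.log (a / b) := by
  rcases ha.eq_or_lt with rfl | ha
  · simp only [zero_mul, zero_div, zero_add, zero_sub]
    nlinarith
  · have hb : 0 < b := hb.lt_of_ne fun h => ha.ne' (hab h.symm)
    have h1 := Real.one_sub_inv_le_log_of_pos (show 0 < a / b / r by positivity)
    rw [Real.log_div (by positivity) hr.ne'] at h1
    have h2 : a * (1 - (a / b / r)⁻¹) = a - r * b := by field_simp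
    nlinarith [mul_le_mul_of_nonneg_left h1 ha.le]

/-- The log-sum inequality for two terms. -/
lemma log_sum_two {a₁ a₂ b₁ b₂ : ℝ} (ha₁ : 0 ≤ a₁) (ha₂ : 0 ≤ a₂) (hb₁ : 0 ≤ b₁) (hb₂ : 0 ≤ b₂)
    (h₁ : b₁ = 0 → a₁ = 0) (h₂ : b₂ = 0 → a₂ = 0) :
    (a₁ + a₂) * Real.log ((a₁ + a₂) / (b₁ + b₂)) ≤
      a₁ * Real.log (a₁ / b₁) + a₂ * Real.log (a₂ / b₂) := by
  rcases (add_nonneg ha₁ ha₂).eq_or_lt with h | h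
  · have e₁ : a₁ = 0 := by linarith
    have e₂ : a₂ = 0 := by linarith
    simp [e₁, e₂]
  · have hb : 0 < b₁ + b₂ := by
      refine (add_nonneg hb₁ hb₂).lt_of_ne fun hb => h.ne' ?_
      rw [h₁ (by linarith), h₂ (by linarith), add_zero]
    -- Both tangents are taken at the ratio of the totals, so that the linear terms cancel in the
    -- sum.
    have hr := div_pos h hb
    have t₁ := mul_log_div_ge ha₁ hb₁ h₁ hr
    have t₂ := mul_log_div_ge ha₂ hb₂ h₂ hr
    have : (a₁ + a₂) / (b₁ + b₂) * (b₁ + b₂) = a₁ + a₂ := div_mul_cancel₀ _ hb.ne'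
    nlinarith

/-- Joint convexity of the divergence. -/
lemma klReal_mix_le {Q Q₀ J J₀ : A → ℝ} (hQ : ∀ a, 0 ≤ Q a) (hQ₀ : ∀ a, 0 ≤ Q₀ a)
    (hJ : ∀ a, 0 ≤ J a) (hJ₀ : ∀ a, 0 ≤ J₀ a) (h : ∀ a, J a = 0 → Q a = 0)
    (h₀ : ∀ a, J₀ a = 0 → Q₀ a = 0) {ε : ℝ} (hε : 0 < ε) (hε1 : ε < 1) :
    klReal (fun a => (1 - ε) * Q a + ε * Q₀ a) (fun a => (1 - ε) * J a + ε * J₀ a) ≤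
      (1 - ε) * klReal Q J + ε * klReal Q₀ J₀ := by
  simp only [klReal, Finset.mul_sum, ← Finset.sum_add_distrib]
  refine Finset.sum_le_sum fun a _ => ?_
  have h1 : 0 < 1 - ε := by linarith
  have := log_sum_two (mul_nonneg h1.le (hQ a)) (mul_nonneg hε.le (hQ₀ a))
    (mul_nonneg h1.le (hJ a)) (mul_nonneg hε.le (hJ₀ a))
    (fun e => by rw [h a ((mul_eq_zero.1 e).resolve_left h1.ne'), mul_zero])
    (fun e => by rw [h₀ a ((mul_eq_zero.1 e).resolve_left hε.ne'), mul_zero])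
  rwa [mul_div_mul_left _ _ h1.ne', mul_div_mul_left _ _ hε.ne', mul_assoc, mul_assoc] at this

lemma sum_mul_exp_pos {J : A → ℝ} (hJ : J ∈ stdSimplex ℝ A) (u : A → ℝ) :
    0 < ∑ a, J a * Real.exp (u a) := by
  have h0 : ∀ a, 0 ≤ J a * Real.exp (u a) := fun a => mul_nonneg (hJ.1 a) (Real.exp_nonneg _)
  refine (Finset.sum_nonneg fun a _ => h0 a).lt_of_ne fun h => ?_
  have := (Finset.sum_eq_zero_iff_of_nonneg fun a _ => h0 a).1 h.symm
  have hz : ∑ a, J a = 0 := Finset.sum_eq_zero fun a ha =>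
    (mul_eq_zero.1 (this a ha)).resolve_right (Real.exp_pos _).ne'
  rw [hJ.2] at hz
  exact one_ne_zero hz

/-- Weak duality between the divergence and exponential moments. -/
lemma neg_log_sum_exp_le_klReal {Q J : A → ℝ} (hQ : Q ∈ stdSimplex ℝ A) (hJ : J ∈ stdSimplex ℝ A)
    (h : ∀ a, J a = 0 → Q a = 0) {g : A → ℝ} (hg : ∑ a, Q a * g a ≤ 0) {s : ℝ} (hs : 0 ≤ s) :
    -Real.log (∑ a, J a * Real.exp (-(s * g a))) ≤ klReal Q J := by
  set φ := ∑ a, J a * Real.exp (-(s * g a)) with hφ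
  have hφ0 : 0 < φ := sum_mul_exp_pos hJ _
  -- The tangent is taken at the density `exp (-s g) / φ` of the tilted law.
  have key : ∀ a, -s * (Q a * g a) - Q a * Real.log φ + Q a -
      (J a * Real.exp (-(s * g a))) / φ ≤ Q a * Real.log (Q a / J a) := by
    intro a
    have := mul_log_div_ge (hQ.1 a) (hJ.1 a) (h a)
      (show 0 < Real.exp (-(s * g a)) / φ by positivity)
    rw [Real.log_div (Real.exp_pos _).ne' hφ0.ne', Real.log_exp] at this
    calc _ = Q a * (-(s * g a) - Real.log φ) + Q a - Real.exp (-(s * g a)) / φ * J a := by ring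
      _ ≤ _ := this
  have hsum := Finset.sum_le_sum fun a (_ : a ∈ Finset.univ) => key a
  simp only [Finset.sum_sub_distrib, Finset.sum_add_distrib, ← Finset.mul_sum, ← Finset.sum_mul,
    ← Finset.sum_div, hQ.2, ← hφ, div_self hφ0.ne'] at hsum
  have : 0 ≤ s * -(∑ a, Q a * g a) := mul_nonneg hs (by linarith)
  simp only [klReal]
  linarith

/-- Equality case of weak duality: `h0` says that `g` has mean zero under the tilted law, so only
the normalizing constant survives in the divergence. -/
lemma klReal_tilt {J : A → ℝ} (hJ : J ∈ stdSimplex ℝ A) (g : A → ℝ) (s : ℝ)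
    (h0 : ∑ a, J a * g a * Real.exp (-(s * g a)) = 0) :
    klReal (fun a => J a * Real.exp (-(s * g a)) / ∑ b, J b * Real.exp (-(s * g b))) J =
      -Real.log (∑ b, J b * Real.exp (-(s * g b))) := by
  set φ := ∑ a, J a * Real.exp (-(s * g a)) with hφ
  have hφ0 : 0 < φ := sum_mul_exp_pos hJ _
  have : ∀ a, J a * Real.exp (-(s * g a)) / φ *
      Real.log (J a * Real.exp (-(s * g a)) / φ / J a) =
      -s / φ * (J a * g a * Real.exp (-(s * g a))) -
        (J a * Real.exp (-(s * g a))) * (Real.log φ / φ) := by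
    intro a
    rcases eq_or_ne (J a) 0 with hz | hz
    · simp [hz]
    · rw [show J a * Real.exp (-(s * g a)) / φ / J a = Real.exp (-(s * g a)) / φ by field_simp,
        Real.log_div (Real.exp_pos _).ne' hφ0.ne', Real.log_exp]
      ring
  simp only [klReal, this, Finset.sum_sub_distrib, ← Finset.mul_sum, ← Finset.sum_mul, h0, ← hφ]
  field_simp
  ring

/-- Intermediate value theorem in `s`: the sum is positive at `s = 0`, and for large `s` the growing
negative term at `b` outweighs all the others, each of which stays below `J a * |g a|`. -/
lemma exists_tilt_of_neg {J : A → ℝ} (hJ0 : ∀ a, 0 ≤ J a) {g : A → ℝ} {b : A} (hb : 0 < J b)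
    (hgb : g b < 0) (hpos : 0 < ∑ a, J a * g a) :
    ∃ s : ℝ, 0 ≤ s ∧ ∑ a, J a * g a * Real.exp (-(s * g a)) = 0 := by
  classical
  set h : ℝ → ℝ := fun s => ∑ a, J a * g a * Real.exp (-(s * g a)) with hh
  have hcont : Continuous h := by fun_prop
  have hle : ∀ s, 0 ≤ s → h s ≤ ∑ a, J a * |g a| + J b * g b * Real.exp (-(s * g b)) := by
    intro s hs
    rw [hh]
    dsimp only
    rw [← Finset.add_sum_erase _ _ (Finset.mem_univ b), add_comm]
    refine add_le_add_left ?_ _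
    refine le_trans (Finset.sum_le_sum (g := fun a => J a * |g a|) fun a _ => ?_)
      (Finset.sum_le_sum_of_subset_of_nonneg (Finset.erase_subset _ _)
        fun a _ _ => mul_nonneg (hJ0 a) (abs_nonneg _))
    rw [mul_assoc]
    refine mul_le_mul_of_nonneg_left ?_ (hJ0 a)
    rcases le_or_gt 0 (g a) with hg | hg
    · rw [abs_of_nonneg hg]
      have : Real.exp (-(s * g a)) ≤ 1 := Real.exp_le_one_iff.2 (by nlinarith)
      nlinarith
    · have := Real.exp_pos (-(s * g a))
      nlinarith [abs_nonneg (g a)]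
  have htend : Tendsto (fun s : ℝ => Real.exp (-(s * g b))) atTop atTop := by
    refine Real.tendsto_exp_atTop.comp ?_
    have : (fun s : ℝ => -(s * g b)) = fun s => s * (-g b) := by ext; ring
    rw [this]
    exact tendsto_id.atTop_mul_const (by linarith)
  have hev := htend.eventually_ge_atTop ((∑ a, J a * |g a|) / (J b * -g b))
  obtain ⟨s, hs0, hs⟩ := ((eventually_ge_atTop 0).and hev).exists
  have hneg : h s ≤ 0 := by
    have := hle s hs0
    rw [div_le_iff₀ (mul_pos hb (by linarith))] at hs
    linarith
  have h0 : 0 ≤ h 0 := by simpa [hh] using hpos.le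
  obtain ⟨r, hr, hr0⟩ := intermediate_value_Icc' hs0 hcont.continuousOn ⟨hneg, h0⟩
  exact ⟨r, hr.1, hr0⟩

/-- Strong duality: the least divergence under a linear constraint is reached by exponential
moments. -/
lemma exists_sum_exp_lt {J : A → ℝ} (hJ : J ∈ stdSimplex ℝ A) (g : A → ℝ) (K : ℝ)
    (h : ∀ Q ∈ stdSimplex ℝ A, (∀ a, J a = 0 → Q a = 0) → ∑ a, Q a * g a ≤ 0 → K < klReal Q J) :
    ∃ s : ℝ, 0 ≤ s ∧ ∑ a, J a * Real.exp (-(s * g a)) < Real.exp (-K) := by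
  classical
  -- If `J` is itself admissible, then `K < 0` and `s = 0` suffices. Otherwise a tilt with mean zero
  -- is optimal, provided `g` is negative somewhere on the support.
  rcases le_or_gt (∑ a, J a * g a) 0 with hE | hE
  · refine ⟨0, le_rfl, ?_⟩
    have := h J hJ (fun _ => id) hE
    rw [klReal_self] at this
    simpa [hJ.2] using this
  by_cases hneg : ∃ b, 0 < J b ∧ g b < 0
  · obtain ⟨b, hb, hgb⟩ := hneg
    obtain ⟨s, hs, h0⟩ := exists_tilt_of_neg hJ.1 hb hgb hE
    refine ⟨s, hs, ?_⟩
    have hkl := klReal_tilt hJ g s h0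
    set φ := ∑ a, J a * Real.exp (-(s * g a)) with hφ
    have hφ0 : 0 < φ := sum_mul_exp_pos hJ _
    have := h (fun a => J a * Real.exp (-(s * g a)) / φ)
      ⟨fun a => div_nonneg (mul_nonneg (hJ.1 a) (Real.exp_nonneg _)) hφ0.le, by
        rw [← Finset.sum_div, ← hφ, div_self hφ0.ne']⟩
      (fun a ha => by simp [ha]) (by
        have e : ∀ a, J a * Real.exp (-(s * g a)) / φ * g a =
          J a * g a * Real.exp (-(s * g a)) / φ := fun a => by ring
        simp only [e, ← Finset.sum_div, h0, zero_div, le_refl])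
    rw [hkl] at this
    rw [← Real.log_lt_iff_lt_exp hφ0]
    linarith
  push Not at hneg
  -- now `g ≥ 0` on the support of `J`
  set p := ∑ a, if g a = 0 then J a else 0 with hp
  have hlim : Tendsto (fun s : ℝ => ∑ a, J a * Real.exp (-(s * g a))) atTop (𝓝 p) := by
    refine tendsto_finsetSum _ fun a _ => ?_
    rcases (hJ.1 a).eq_or_lt with hz | hz
    · simp [← hz]
    rcases (hneg a hz).eq_or_lt with hg | hg
    · simp [← hg]
    · rw [if_neg hg.ne', ← mul_zero (J a)]
      refine Tendsto.const_mul _ (Real.tendsto_exp_neg_atTop_nhds_zero.comp ?_)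
      exact tendsto_id.atTop_mul_const hg
  -- No finite `s` need be optimal here. The limit `p` is the mass of `g = 0`, and `J` conditioned
  -- on that event has divergence `-log p`.
  have hpK : p < Real.exp (-K) := by
    have hp0 : 0 ≤ p := Finset.sum_nonneg fun a _ => by split_ifs; exacts [hJ.1 a, le_rfl]
    rcases hp0.eq_or_lt with hz | hp0
    · rw [← hz]; exact Real.exp_pos _
    have := h (fun a => if g a = 0 then J a / p else 0)
      ⟨fun a => by dsimp only; split_ifs; exacts [div_nonneg (hJ.1 a) hp0.le, le_rfl], by
        have e : ∀ a, (if g a = 0 then J a / p else 0) = (if g a = 0 then J a else 0) / p := by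
          intro a; split_ifs <;> simp
        simp only [e, ← Finset.sum_div]
        exact div_self hp0.ne'⟩
      (fun a ha => by simp [ha])
      (Finset.sum_nonpos fun a _ => by split_ifs with hg <;> simp [hg])
    have hkl : klReal (fun a => if g a = 0 then J a / p else 0) J = -Real.log p := by
      have e : ∀ a, (if g a = 0 then J a / p else 0) *
          Real.log ((if g a = 0 then J a / p else 0) / J a) =
          (if g a = 0 then J a else 0) * (-Real.log p / p) := by
        intro a
        split_ifs with hg
        · rcases eq_or_ne (J a) 0 with hz | hz
          · simp [hz]
          · rw [show J a / p / J a = p⁻¹ by field_simp, Real.log_inv]; ring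
        · simp
      simp only [klReal, e, ← Finset.sum_mul, ← hp]
      field_simp
    rw [hkl] at this
    rw [← Real.log_lt_iff_lt_exp hp0]
    linarith
  obtain ⟨s, hs, hs'⟩ := ((hlim.eventually_lt_const hpK).and (eventually_ge_atTop 0)).exists
  exact ⟨s, hs', hs⟩

end RealDivergence

set_option linter.unusedSectionVars false

/-! ### Mechanisms, time sharing and the joint laws. -/

section Mechanisms
variable {X Y Xh : Type*} [Fintype X] [Fintype Y] [Fintype Xh]

/-- Time sharing of two mechanisms. -/
def mix {A C : Type*} (ε : ℝ) (W W₀ : A → C → ℝ) : A → C → ℝ :=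
  fun p z => (1 - ε) * W p z + ε * W₀ p z

lemma isMechanism_mix {W W₀ : X × Y → Xh → ℝ} (hW : IsMechanism W) (hW₀ : IsMechanism W₀) {ε : ℝ}
    (hε : 0 ≤ ε) (hε1 : ε ≤ 1) : IsMechanism (mix ε W W₀) := by
  intro p
  have := convex_stdSimplex ℝ Xh (hW p) (hW₀ p) (sub_nonneg.2 hε1) hε (by ring)
  exact this

lemma jointX_mix (P : X × Y → ℝ) (W W₀ : X × Y → Xh → ℝ) (ε : ℝ) :
    jointX P (mix ε W W₀) = fun a => (1 - ε) * jointX P W a + ε * jointX P W₀ a := by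
  ext a
  simp only [jointX, mix, Finset.mul_sum, ← Finset.sum_add_distrib]
  exact Finset.sum_congr rfl fun _ _ => by ring

lemma jointY_mix (P : X × Y → ℝ) (W W₀ : X × Y → Xh → ℝ) (ε : ℝ) :
    jointY P (mix ε W W₀) = fun a => (1 - ε) * jointY P W a + ε * jointY P W₀ a := by
  ext a
  simp only [jointY, mix, Finset.mul_sum, ← Finset.sum_add_distrib]
  exact Finset.sum_congr rfl fun _ _ => by ring

lemma continuous_mix {A C : Type*} (W W₀ : A → C → ℝ) : Continuous fun ε => mix ε W W₀ := by
  unfold mix; fun_prop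

lemma mix_zero {A C : Type*} (W W₀ : A → C → ℝ) : mix 0 W W₀ = W := by
  ext; simp [mix]

lemma jointX_mem_stdSimplex {P : X × Y → ℝ} (hP : P ∈ stdSimplex ℝ (X × Y))
    {W : X × Y → Xh → ℝ} (hW : IsMechanism W) : jointX P W ∈ stdSimplex ℝ (X × Xh) := by
  refine ⟨fun a => Finset.sum_nonneg fun y _ => mul_nonneg (hP.1 _) ((hW _).1 _), ?_⟩
  simp only [jointX, Fintype.sum_prod_type]
  rw [← hP.2, Fintype.sum_prod_type]
  refine Finset.sum_congr rfl fun x _ => ?_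
  rw [Finset.sum_comm]
  refine Finset.sum_congr rfl fun y _ => ?_
  rw [← Finset.mul_sum, (hW (x, y)).2, mul_one]

lemma jointY_mem_stdSimplex {P : X × Y → ℝ} (hP : P ∈ stdSimplex ℝ (X × Y))
    {W : X × Y → Xh → ℝ} (hW : IsMechanism W) : jointY P W ∈ stdSimplex ℝ (Y × Xh) := by
  refine ⟨fun a => Finset.sum_nonneg fun y _ => mul_nonneg (hP.1 _) ((hW _).1 _), ?_⟩
  simp only [jointY, Fintype.sum_prod_type]
  rw [← hP.2, Fintype.sum_prod_type_right]
  refine Finset.sum_congr rfl fun y _ => ?_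
  rw [Finset.sum_comm]
  refine Finset.sum_congr rfl fun x _ => ?_
  rw [← Finset.mul_sum, (hW (x, y)).2, mul_one]

lemma continuous_jointX (P : X × Y → ℝ) :
    Continuous fun W : X × Y → Xh → ℝ => jointX P W := by
  unfold jointX; fun_prop

lemma continuous_jointY (P : X × Y → ℝ) :
    Continuous fun W : X × Y → Xh → ℝ => jointY P W := by
  unfold jointY; fun_prop

lemma isCompact_setOf_isMechanism :
    IsCompact {W : X × Y → Xh → ℝ | IsMechanism W} := by
  have := isCompact_univ_pi fun _ : X × Y => isCompact_stdSimplex (𝕜 := ℝ) (ι := Xh)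
  convert this using 1
  ext W
  simp [IsMechanism]

lemma sum_pos_of_jointX_ne_zero {P : X × Y → ℝ} (hP : P ∈ stdSimplex ℝ (X × Y))
    {W : X × Y → Xh → ℝ} {a : X × Xh} (h : jointX P W a ≠ 0) : 0 < ∑ y, P (a.1, y) := by
  refine (Finset.sum_nonneg fun y _ => hP.1 _).lt_of_ne fun h0 => h ?_
  have := (Finset.sum_eq_zero_iff_of_nonneg fun y _ => hP.1 (a.1, y)).1 h0.symm
  exact Finset.sum_eq_zero fun y hy => by rw [this y hy, zero_mul]

/-- A deterministic choice of a best reproduction letter. This mechanism shows that the constraint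
sets are nonempty and is the one mixed in for achievability. -/
lemma exists_mechanism_eq_min {P : X × Y → ℝ} (hP : P ∈ stdSimplex ℝ (X × Y)) {d : X → Xh → ℝ}
    {Dmin : ℝ} (hDmin : ∀ x, 0 < ∑ y, P (x, y) → ∃ z, d x z = Dmin) :
    ∃ W : X × Y → Xh → ℝ, IsMechanism W ∧ ∀ a, jointX P W a ≠ 0 → d a.1 a.2 = Dmin := by
  classical
  have hne : Nonempty Xh := by
    by_contra hcon
    have h0 : ∀ x, ∑ y, P (x, y) = 0 := fun x => by
      by_contra h
      have h' : 0 < ∑ y, P (x, y) :=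
        (Finset.sum_nonneg fun y _ => hP.1 _).lt_of_ne fun e => h e.symm
      exact hcon ⟨(hDmin x h').choose⟩
    have := hP.2
    rw [Fintype.sum_prod_type] at this
    simp [h0] at this
  have : ∀ x, ∃ z, 0 < ∑ y, P (x, y) → d x z = Dmin := by
    intro x
    by_cases h : 0 < ∑ y, P (x, y)
    · obtain ⟨z, hz⟩ := hDmin x h
      exact ⟨z, fun _ => hz⟩
    · exact ⟨Classical.arbitrary Xh, fun h' => absurd h' h⟩
  choose z hz using this
  refine ⟨fun p => Pi.single (z p.1) 1, fun p => single_mem_stdSimplex ℝ _, ?_⟩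
  rintro ⟨x, w⟩ ha
  have hx := sum_pos_of_jointX_ne_zero hP ha
  by_cases hw : w = z x
  · rw [hw]; exact hz x hx
  · exact absurd (Finset.sum_eq_zero fun y _ => by simp [hw]) ha

end Mechanisms

/-! ### Mutual information: continuity, convexity, additivity. -/

section Information
variable {A B : Type*} [Fintype A] [Fintype B]

lemma mutualInfo_eq_klReal (K : A × B → ℝ) :
    mutualInfo K = klReal K (fun p => (∑ b, K (p.1, b)) * ∑ a, K (a, p.2)) := by
  rw [klReal, Fintype.sum_prod_type]
  rfl

lemma marginals_ac {K : A × B → ℝ} (hK : ∀ p, 0 ≤ K p) (p : A × B)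
    (h : (∑ b, K (p.1, b)) * ∑ a, K (a, p.2) = 0) : K p = 0 := by
  rcases mul_eq_zero.1 h with h | h
  · exact (Finset.sum_eq_zero_iff_of_nonneg fun b _ => hK (p.1, b)).1 h p.2 (Finset.mem_univ _)
  · exact (Finset.sum_eq_zero_iff_of_nonneg fun a _ => hK (a, p.2)).1 h p.1 (Finset.mem_univ _)

/-- The form `H(A) + H(B) - H(A, B)` makes continuity visible also where entries vanish. -/
lemma mutualInfo_eq_negMulLog {K : A × B → ℝ} (hK : ∀ p, 0 ≤ K p) :
    mutualInfo K = (∑ a, Real.negMulLog (∑ b, K (a, b))) + (∑ b, Real.negMulLog (∑ a, K (a, b))) -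
      ∑ a, ∑ b, Real.negMulLog (K (a, b)) := by
  have key : ∀ a b, K (a, b) * Real.log (K (a, b) / ((∑ b', K (a, b')) * ∑ a', K (a', b))) =
      -(K (a, b) * Real.log (∑ b', K (a, b'))) - K (a, b) * Real.log (∑ a', K (a', b)) -
        Real.negMulLog (K (a, b)) := by
    intro a b
    rcases eq_or_ne (K (a, b)) 0 with h | h
    · simp [h]
    · have hm : (∑ b', K (a, b')) * ∑ a', K (a', b) ≠ 0 := fun h0 => h (marginals_ac hK (a, b) h0)
      rw [Real.log_div h hm, Real.log_mul (left_ne_zero_of_mul hm) (right_ne_zero_of_mul hm),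
        Real.negMulLog]
      ring
  simp only [mutualInfo, key, Finset.sum_sub_distrib, Finset.sum_neg_distrib]
  rw [Finset.sum_comm (f := fun a b => K (a, b) * Real.log (∑ a', K (a', b)))]
  simp only [← Finset.sum_mul, Real.negMulLog, neg_mul, Finset.sum_neg_distrib]
  ring

lemma continuousOn_mutualInfo : ContinuousOn mutualInfo {K : A × B → ℝ | ∀ p, 0 ≤ K p} := by
  have : Continuous fun K : A × B → ℝ =>
      (∑ a, Real.negMulLog (∑ b, K (a, b))) + (∑ b, Real.negMulLog (∑ a, K (a, b))) -
      ∑ a, ∑ b, Real.negMulLog (K (a, b)) := by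
    have := Real.continuous_negMulLog
    fun_prop
  exact this.continuousOn.congr fun K hK => mutualInfo_eq_negMulLog hK

/-- Mixing a joint law with the product of its marginals scales the information down. -/
lemma mutualInfo_mix_marginals_le {K : A × B → ℝ} (hK : K ∈ stdSimplex ℝ (A × B)) {ε : ℝ}
    (hε : 0 < ε) (hε1 : ε < 1) :
    mutualInfo (fun p => (1 - ε) * K p + ε * ((∑ b, K (p.1, b)) * ∑ a, K (a, p.2))) ≤
      (1 - ε) * mutualInfo K := by
  have hsum : ∑ a, ∑ b, K (a, b) = 1 := by rw [← Fintype.sum_prod_type]; exact hK.2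
  have hsum' : ∑ b, ∑ a, K (a, b) = 1 := by rw [Finset.sum_comm]; exact hsum
  have hm : ∀ p : A × B, 0 ≤ (∑ b, K (p.1, b)) * ∑ a, K (a, p.2) := fun p =>
    mul_nonneg (Finset.sum_nonneg fun _ _ => hK.1 _) (Finset.sum_nonneg fun _ _ => hK.1 _)
  -- The mixture has the same marginals as `K`, so both reference laws are the same product of
  -- marginals.
  have := klReal_mix_le hK.1 hm hm hm (marginals_ac hK.1) (fun _ => id) hε hε1
  rw [klReal_self, mul_zero, add_zero, ← mutualInfo_eq_klReal] at this
  refine le_trans (le_of_eq ?_) this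
  rw [mutualInfo_eq_klReal]
  congr 1
  ext ⟨a, b⟩
  simp only [Finset.sum_add_distrib, ← Finset.mul_sum, ← Finset.sum_mul, hsum, hsum']
  ring

/-- The law of `n` independent copies of a pair, as a law on pairs of sequences. -/
def powPair (K : A × B → ℝ) (n : ℕ) : (Fin n → A) × (Fin n → B) → ℝ :=
  fun p => ∏ i, K (p.1 i, p.2 i)

lemma sum_powPair_mul (K : A × B → ℝ) (n : ℕ) (F : (Fin n → A × B) → ℝ) :
    ∑ p, powPair K n p * F (fun i => (p.1 i, p.2 i)) = iidExpect K n F := by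
  rw [iidExpect]
  exact ((Equiv.arrowProdEquivProdArrow (Fin n) (fun _ => A) (fun _ => B)).symm.sum_comp
    fun a => (∏ i, K (a i)) * F a)

lemma sum_pi_prod_eq {ι : Type*} [Fintype ι] [DecidableEq ι] {C : Type*} [Fintype C]
    (g : ι → C → ℝ) : ∑ c : ι → C, ∏ i, g i (c i) = ∏ i, ∑ c, g i c := by
  rw [Finset.prod_univ_sum, Fintype.piFinset_univ]

/-- On sequences of positive probability the log-ratio splits into a sum over the letters, whose
expectation is `n` times the single-letter one. -/
lemma mutualInfo_powPair {K : A × B → ℝ} (hK : K ∈ stdSimplex ℝ (A × B)) (n : ℕ) :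
    mutualInfo (powPair K n) = n * mutualInfo K := by
  set r : A × B → ℝ := fun p => Real.log (K p / ((∑ b, K (p.1, b)) * ∑ a, K (a, p.2))) with hr
  have h1 : mutualInfo (powPair K n) = iidExpect K n (fun c => Real.log ((∏ i, K (c i)) /
      ((∏ i, ∑ b, K ((c i).1, b)) * ∏ i, ∑ a, K (a, (c i).2)))) := by
    rw [← sum_powPair_mul, mutualInfo_eq_klReal, klReal]
    refine Finset.sum_congr rfl fun p _ => ?_
    simp only [powPair]
    rw [sum_pi_prod_eq fun i b => K (p.1 i, b), sum_pi_prod_eq fun i a => K (a, p.2 i)]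
  have h2 : ∀ c : Fin n → A × B, (∀ i, K (c i) ≠ 0) → Real.log ((∏ i, K (c i)) /
      ((∏ i, ∑ b, K ((c i).1, b)) * ∏ i, ∑ a, K (a, (c i).2))) = ∑ i, r (c i) := by
    intro c hc
    rw [← Finset.prod_mul_distrib, ← Finset.prod_div_distrib, Real.log_prod]
    exact fun i _ => div_ne_zero (hc i) fun h => hc i (marginals_ac hK.1 (c i) h)
  rw [h1, le_antisymm (iidExpect_mono hK.1 fun c hc => (h2 c hc).le)
    (iidExpect_mono hK.1 fun c hc => (h2 c hc).ge), iidExpect_sum hK.2, mutualInfo_eq_klReal]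
  rfl

end Information

/-! ### Reduction to single-letter mechanisms and existence of minima. -/

section Powers
variable {X Y Xh : Type*} [Fintype X] [Fintype Y] [Fintype Xh]

lemma jointX_pow (P : X × Y → ℝ) (W : X × Y → Xh → ℝ) (n : ℕ) :
    jointX (powSource P n) (powMechanism W n) = powPair (jointX P W) n := by
  classical
  ext p
  simp only [jointX, powSource, powMechanism, powPair, ← Finset.prod_mul_distrib]
  exact sum_pi_prod_eq fun i y => P (p.1 i, y) * W (p.1 i, y) (p.2 i)

lemma jointY_pow (P : X × Y → ℝ) (W : X × Y → Xh → ℝ) (n : ℕ) :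
    jointY (powSource P n) (powMechanism W n) = powPair (jointY P W) n := by
  classical
  ext p
  simp only [jointY, powSource, powMechanism, powPair, ← Finset.prod_mul_distrib]
  exact sum_pi_prod_eq fun i x => P (x, p.1 i) * W (x, p.1 i) (p.2 i)

/-- The memoryless mechanism built from `W` meets the cost constraint at block length `n`. -/
def Feasible (P : X × Y → ℝ) (d : X → Xh → ℝ) (f : ℝ → ℝ) (t : ℝ) (n : ℕ)
    (W : X × Y → Xh → ℝ) : Prop :=
  iidExpect (jointX P W) n (fun a => f ((1 / (n : ℝ)) * ∑ i, d (a i).1 (a i).2)) ≤ t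

/-- The factor `1 / n` cancels the additivity of information: the objective is independent of `n`,
and only the feasible set varies. -/
lemma memorylessLeakages_eq {P : X × Y → ℝ} (hP : P ∈ stdSimplex ℝ (X × Y)) (d : X → Xh → ℝ)
    (f : ℝ → ℝ) (t : ℝ) {n : ℕ} (hn : 1 ≤ n) :
    memorylessLeakages P d f t n =
      (fun W => mutualInfo (jointY P W)) '' {W | IsMechanism W ∧ Feasible P d f t n W} := by
  have hn0 : (n : ℝ) ≠ 0 := by exact_mod_cast (by omega : n ≠ 0)
  have hexp : ∀ W : X × Y → Xh → ℝ,
      expect (jointX (powSource P n) (powMechanism W n)) (fun p => f (seqDist d p.1 p.2)) =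
      iidExpect (jointX P W) n (fun a => f ((1 / (n : ℝ)) * ∑ i, d (a i).1 (a i).2)) := by
    intro W
    rw [jointX_pow, ← sum_powPair_mul]
    rfl
  have hinf : ∀ W : X × Y → Xh → ℝ, IsMechanism W →
      (1 / (n : ℝ)) * mutualInfo (jointY (powSource P n) (powMechanism W n)) =
        mutualInfo (jointY P W) := by
    intro W hW
    rw [jointY_pow, mutualInfo_powPair (jointY_mem_stdSimplex hP hW)]
    field_simp
  ext r
  constructor
  · rintro ⟨W, hW, hf, rfl⟩
    exact ⟨W, ⟨hW, (hexp W).symm.trans_le hf⟩, (hinf W hW).symm⟩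
  · rintro ⟨W, ⟨hW, hf⟩, rfl⟩
    exact ⟨W, hW, (hexp W).trans_le hf, (hinf W hW).symm⟩

lemma continuous_iidExpect {A : Type*} [Fintype A] (n : ℕ) (F : (Fin n → A) → ℝ) :
    Continuous fun J : A → ℝ => iidExpect J n F := by
  unfold iidExpect; fun_prop

lemma isClosed_setOf_feasible (P : X × Y → ℝ) (d : X → Xh → ℝ) (f : ℝ → ℝ) (t : ℝ) (n : ℕ) :
    IsClosed {W : X × Y → Xh → ℝ | Feasible P d f t n W} :=
  isClosed_le ((continuous_iidExpect n _).comp (continuous_jointX P)) continuous_const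

lemma continuousOn_mutualInfo_jointY {P : X × Y → ℝ} (hP : P ∈ stdSimplex ℝ (X × Y)) :
    ContinuousOn (fun W : X × Y → Xh → ℝ => mutualInfo (jointY P W)) {W | IsMechanism W} :=
  continuousOn_mutualInfo.comp (continuous_jointY P).continuousOn
    fun _ hW => (jointY_mem_stdSimplex hP hW).1

lemma isLeast_memorylessLeakages {P : X × Y → ℝ} (hP : P ∈ stdSimplex ℝ (X × Y))
    {d : X → Xh → ℝ} {f : ℝ → ℝ} {t : ℝ} {n : ℕ} (hn : 1 ≤ n) {W₀ : X × Y → Xh → ℝ}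
    (hW₀ : IsMechanism W₀) (hf : Feasible P d f t n W₀) :
    IsLeast (memorylessLeakages P d f t n) (LM P d f t n) := by
  rw [LM, memorylessLeakages_eq hP d f t hn]
  have hc : IsCompact {W : X × Y → Xh → ℝ | IsMechanism W ∧ Feasible P d f t n W} :=
    isCompact_setOf_isMechanism.inter_right (isClosed_setOf_feasible P d f t n)
  exact (hc.image_of_continuousOn
    ((continuousOn_mutualInfo_jointY hP).mono fun _ h => h.1)).isLeast_sInf ⟨_, W₀, ⟨hW₀, hf⟩, rfl⟩

lemma isLeast_singleLetterLeakages {P : X × Y → ℝ} (hP : P ∈ stdSimplex ℝ (X × Y))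
    {d : X → Xh → ℝ} {D : ℝ} {W₀ : X × Y → Xh → ℝ}
    (hW₀ : IsMechanism W₀) (hf : expect (jointX P W₀) (fun p => d p.1 p.2) ≤ D) :
    IsLeast (singleLetterLeakages P d D) (L P d D) := by
  have he : singleLetterLeakages P d D = (fun W => mutualInfo (jointY P W)) ''
      {W | IsMechanism W ∧ expect (jointX P W) (fun p => d p.1 p.2) ≤ D} := by
    ext r
    constructor
    · rintro ⟨W, hW, h, rfl⟩
      exact ⟨W, ⟨hW, h⟩, rfl⟩
    · rintro ⟨W, ⟨hW, h⟩, rfl⟩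
      exact ⟨W, hW, h, rfl⟩
  rw [L, he]
  have hcl : IsClosed {W : X × Y → Xh → ℝ | expect (jointX P W) (fun p => d p.1 p.2) ≤ D} := by
    refine isClosed_le ?_ continuous_const
    have := continuous_jointX (Xh := Xh) P
    unfold expect
    fun_prop
  have hc : IsCompact {W : X × Y → Xh → ℝ |
      IsMechanism W ∧ expect (jointX P W) (fun p => d p.1 p.2) ≤ D} :=
    isCompact_setOf_isMechanism.inter_right hcl
  exact (hc.image_of_continuousOn
    ((continuousOn_mutualInfo_jointY hP).mono fun _ h => h.1)).isLeast_sInf ⟨_, W₀, ⟨hW₀, hf⟩, rfl⟩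

end Powers

/-! ### Cost constraint versus exponents. -/

section Cost
variable {A : Type*} [Fintype A]

lemma avg_mem_Icc {a b : ℝ} {n : ℕ} (hn : 0 < n) {u : Fin n → ℝ} (hu : ∀ i, u i ∈ Icc a b) :
    (1 / (n : ℝ)) * ∑ i, u i ∈ Icc a b := by
  have hn' : (0 : ℝ) < n := by exact_mod_cast hn
  rw [one_div_mul_eq_div]
  constructor
  · rw [le_div_iff₀ hn']
    simpa [mul_comm] using Finset.card_nsmul_le_sum Finset.univ u a fun i _ => (hu i).1
  · rw [div_le_iff₀ hn']
    simpa [mul_comm] using Finset.sum_le_card_nsmul Finset.univ u b fun i _ => (hu i).2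

lemma avg_le_iff {n : ℕ} (hn : 0 < n) (u : Fin n → ℝ) (c : ℝ) :
    (1 / (n : ℝ)) * ∑ i, u i ≤ c ↔ 0 ≤ ∑ i, (c - u i) := by
  have hn' : (0 : ℝ) < n := by exact_mod_cast hn
  rw [one_div_mul_eq_div, div_le_iff₀ hn']
  simp [mul_comm]

lemma le_avg_iff {n : ℕ} (hn : 0 < n) (u : Fin n → ℝ) (c : ℝ) :
    c ≤ (1 / (n : ℝ)) * ∑ i, u i ↔ 0 ≤ ∑ i, (u i - c) := by
  have hn' : (0 : ℝ) < n := by exact_mod_cast hn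
  rw [one_div_mul_eq_div, le_div_iff₀ hn']
  simp [mul_comm]

lemma sum_mul_mem_Icc {Q : A → ℝ} (hQ : Q ∈ stdSimplex ℝ A) {a b : ℝ} {u : A → ℝ}
    (hu : ∀ i, u i ∈ Icc a b) : ∑ i, Q i * u i ∈ Icc a b := by
  constructor
  · calc a = ∑ i, Q i * a := by rw [← Finset.sum_mul, hQ.2, one_mul]
      _ ≤ _ := Finset.sum_le_sum fun i _ => mul_le_mul_of_nonneg_left (hu i).1 (hQ.1 i)
  · calc _ ≤ ∑ i, Q i * b :=
          Finset.sum_le_sum fun i _ => mul_le_mul_of_nonneg_left (hu i).2 (hQ.1 i)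
      _ = b := by rw [← Finset.sum_mul, hQ.2, one_mul]

lemma sum_mul_sub_const {Q : A → ℝ} (hQ : ∑ i, Q i = 1) (u : A → ℝ) (c : ℝ) :
    ∑ i, Q i * (u i - c) = ∑ i, Q i * u i - c := by
  simp [mul_sub, Finset.sum_sub_distrib, ← Finset.sum_mul, hQ]

lemma sum_mul_const_sub {Q : A → ℝ} (hQ : ∑ i, Q i = 1) (u : A → ℝ) (c : ℝ) :
    ∑ i, Q i * (c - u i) = c - ∑ i, Q i * u i := by
  simp [mul_sub, Finset.sum_sub_distrib, ← Finset.sum_mul, hQ]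

lemma tendsto_exp_mul_mul_pow {φ K : ℝ} (hφ : 0 ≤ φ) (h : φ < Real.exp (-K)) :
    Tendsto (fun n : ℕ => Real.exp (n * K) * φ ^ n) atTop (𝓝 0) := by
  have h1 : Real.exp K * φ < 1 := by
    calc _ < Real.exp K * Real.exp (-K) := mul_lt_mul_of_pos_left h (Real.exp_pos _)
      _ = 1 := by rw [← Real.exp_add]; simp
  have := tendsto_pow_atTop_nhds_zero_of_lt_one (by positivity) h1
  refine this.congr fun n => ?_
  rw [mul_pow, ← Real.exp_nat_mul]

variable {u : A → ℝ} {Dmin Dmax : ℝ} {f : ℝ → ℝ} {t Dl Du : ℝ}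

lemma iidExpect_cost_le_of_support (hu : ∀ a, u a ∈ Icc Dmin Dmax)
    {H : A → ℝ} (hH : H ∈ stdSimplex ℝ A) (hup : ∀ D ∈ Icc Dmin Dmax, D ≤ Du → f D ≤ t) (hsupp : ∀ a, H a ≠ 0 → u a ≤ Du) {n : ℕ}
    (hn : 0 < n) : iidExpect H n (fun a => f ((1 / (n : ℝ)) * ∑ i, u (a i))) ≤ t := by
  refine (iidExpect_mono hH.1 fun a ha => ?_).trans (iidExpect_const hH.2 n t).le
  refine hup _ (avg_mem_Icc hn fun i => hu _) ?_
  rw [avg_le_iff hn]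
  exact Finset.sum_nonneg fun i _ => sub_nonneg.2 (hsupp _ (ha i))

/-- If low distortions are exponentially more likely than distortions above `Du`, the cost
constraint holds at all large block lengths. -/
lemma eventually_iidExpect_cost_le (hu : ∀ a, u a ∈ Icc Dmin Dmax)
    (hf_nonneg : ∀ D ∈ Icc Dmin Dmax, 0 ≤ f D)
    (hf_mono : MonotoneOn f (Icc Dmin Dmax)) (ht : f Dmin < t) (hDl : Dl ≤ Dmax)
    (hlow : ∀ D ∈ Icc Dmin Dmax, D < Dl → f D < t)
    (hup : ∀ D ∈ Icc Dmin Dmax, D ≤ Du → f D ≤ t)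
    {H Q : A → ℝ} (hH : H ∈ stdSimplex ℝ A) (hQ : Q ∈ stdSimplex ℝ A)
    (hac : ∀ a, H a = 0 → Q a = 0)
    (hlowQ : ∑ a, Q a * u a < Dl ∨ ∀ a, Q a ≠ 0 → u a = Dmin) {s : ℝ} (hs : 0 ≤ s)
    (hlt : ∑ a, H a * Real.exp (-(s * (Du - u a))) < Real.exp (-klReal Q H)) :
    ∀ᶠ n : ℕ in atTop, iidExpect H n (fun a => f ((1 / (n : ℝ)) * ∑ i, u (a i))) ≤ t := by
  classical
  have hA : Nonempty A := by
    by_contra h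
    rw [not_nonempty_iff] at h
    simpa using hQ.2
  have hDD : Dmin ≤ Dmax := (hu hA.some).1.trans (hu hA.some).2
  have hmin : Dmin ∈ Icc Dmin Dmax := ⟨le_rfl, hDD⟩
  have hmax : Dmax ∈ Icc Dmin Dmax := ⟨hDD, le_rfl⟩
  -- A level of cost strictly below `t` that `Q` typically stays under: midway between the mean and
  -- `Dl`, or `Dmin` itself when `Q` sits there.
  obtain ⟨D, hD, hfD, hQD⟩ : ∃ D ∈ Icc Dmin Dmax, f D < t ∧
      (0 < ∑ a, Q a * (D - u a) ∨ ∀ a, Q a ≠ 0 → 0 ≤ D - u a) := by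
    rcases hlowQ with h | h
    · have hE := sum_mul_mem_Icc hQ hu
      have hm : (∑ a, Q a * u a + Dl) / 2 ∈ Icc Dmin Dmax :=
        ⟨by linarith [hE.1], by linarith⟩
      refine ⟨_, hm, hlow _ hm (by linarith), Or.inl ?_⟩
      rw [sum_mul_const_sub hQ.2]
      linarith
    · exact ⟨Dmin, hmin, ht, Or.inr fun a ha => by rw [h a ha, sub_self]⟩
  set φ := ∑ a, H a * Real.exp (-(s * (Du - u a))) with hφ
  have hφ0 : 0 < φ := sum_mul_exp_pos hH _
  obtain ⟨K, hK1, hK2⟩ : ∃ K, klReal Q H < K ∧ φ < Real.exp (-K) := by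
    have := (Real.log_lt_iff_lt_exp hφ0).2 hlt
    refine ⟨(klReal Q H - Real.log φ) / 2, by linarith, ?_⟩
    rw [← Real.log_lt_iff_lt_exp hφ0]
    linarith
  have hev := eventually_half_exp_le_iidExpect hQ
    (w := fun a => Real.log (Q a / H a)) hK1 hQD
  have hpos : 0 < (t - f D) / 2 := by linarith
  have hlim := (tendsto_exp_mul_mul_pow hφ0.le hK2).const_mul (f Dmax)
  rw [mul_zero] at hlim
  filter_upwards [hev, hlim.eventually_lt_const hpos, eventually_gt_atTop 0] with n hn1 hn2 hn
  have hlower := hn1 H hH.1 (fun a => by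
    rcases (hQ.1 a).eq_or_lt with h | h
    · rw [← h]; exact mul_nonneg (Real.exp_nonneg _) (hH.1 a)
    · have hHa : 0 < H a := (hH.1 a).lt_of_ne fun e => h.ne' (hac a e.symm)
      rw [Real.exp_log (div_pos h hHa), div_mul_cancel₀ _ hHa.ne'])
  have hupper := iidExpect_indicator_le_pow hH.1 (fun a => Du - u a) hs n
  rw [← hφ] at hupper
  -- Pointwise `f v ≤ t + f Dmax · 1{v ≥ Du} - (t - f D) · 1{v ≤ D}`. The penalty decays like `φ ^
  -- n`, faster than the gain of order `exp (-n K)`.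
  have hpt : iidExpect H n (fun a => f ((1 / (n : ℝ)) * ∑ i, u (a i))) ≤
      iidExpect H n (fun a => (t + f Dmax * (if ∑ i, (Du - u (a i)) ≤ 0 then 1 else 0)) -
        (t - f D) * (if 0 ≤ ∑ i, (D - u (a i)) then 1 else 0)) := by
    refine iidExpect_mono hH.1 fun a _ => ?_
    have hav := avg_mem_Icc hn fun i => hu (a i)
    set v := (1 / (n : ℝ)) * ∑ i, u (a i) with hv
    have h0 := hf_nonneg _ hmax
    have hvmax := hf_mono hav hmax hav.2
    have ht0 := hf_nonneg _ hmin
    by_cases h1 : v ≤ D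
    · have := hf_mono hav hD h1
      rw [if_pos ((avg_le_iff hn _ _).1 h1)]
      split_ifs <;> linarith
    · rw [if_neg (fun h => h1 ((avg_le_iff hn _ _).2 h))]
      by_cases h2 : v ≤ Du
      · have := hup v hav h2
        split_ifs <;> linarith
      · rw [if_pos (le_of_not_ge fun h => h2 ((avg_le_iff hn _ _).2 h))]
        linarith
  rw [iidExpect_sub, iidExpect_add, iidExpect_const hH.2, iidExpect_const_mul,
    iidExpect_const_mul] at hpt
  have hexp : Real.exp (n * K) * Real.exp (-(n * K)) = 1 := by rw [← Real.exp_add]; simp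
  have h0 := hf_nonneg _ hmax
  have hfin : f Dmax * φ ^ n ≤ (t - f D) * (1 / 2 * Real.exp (-(n * K))) := by
    have := mul_le_mul_of_nonneg_left hn2.le (Real.exp_nonneg (-(n * K)))
    calc f Dmax * φ ^ n = Real.exp (-(n * K)) * (f Dmax * (Real.exp (n * K) * φ ^ n)) := by
          linear_combination (-(f Dmax * φ ^ n)) * hexp
      _ ≤ _ := this
      _ = _ := by ring
  have e1 := mul_le_mul_of_nonneg_left hupper h0
  have e2 := mul_le_mul_of_nonneg_left hlower (by linarith : 0 ≤ t - f D)
  linarith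

/-- Conversely, if the cost constraint holds along a sequence of laws, distortions below `Dl` cannot
be exponentially less likely than distortions above `Du`. -/
lemma exp_neg_klReal_le_of_cost_le (hu : ∀ a, u a ∈ Icc Dmin Dmax)
    (hf_nonneg : ∀ D ∈ Icc Dmin Dmax, 0 ≤ f D)
    (hf_mono : MonotoneOn f (Icc Dmin Dmax))
    (hmid : ∀ D ∈ Icc Dmin Dmax, Dl < D → t ≤ f D)
    (hhigh : ∀ D ∈ Icc Dmin Dmax, Du < D → t < f D) (hDu : Dmin ≤ Du) (ht0 : 0 ≤ t)
    {H : ℕ → A → ℝ} {J Q : A → ℝ} (hH : ∀ k, H k ∈ stdSimplex ℝ A) (hJ : J ∈ stdSimplex ℝ A)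
    (hHJ : Tendsto H atTop (𝓝 J)) {N : ℕ → ℕ} (hN : Tendsto N atTop atTop)
    (hcost : ∀ k, iidExpect (H k) (N k) (fun a => f ((1 / (N k : ℝ)) * ∑ i, u (a i))) ≤ t)
    (hQ : Q ∈ stdSimplex ℝ A) (hac : ∀ a, J a = 0 → Q a = 0) (hQu : Du < ∑ a, Q a * u a)
    {s : ℝ} (hs : 0 ≤ s) :
    Real.exp (-klReal Q J) ≤ ∑ a, J a * Real.exp (-(s * (u a - Dl))) := by
  classical
  by_contra! hlt
  have hHJ' : ∀ a, Tendsto (fun k => H k a) atTop (𝓝 (J a)) := tendsto_pi_nhds.1 hHJ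
  have hE := sum_mul_mem_Icc hQ hu
  set c := (Du + ∑ a, Q a * u a) / 2 with hc
  have hcI : c ∈ Icc Dmin Dmax := ⟨by linarith, by linarith [hE.2]⟩
  have hfc := hhigh c hcI (by linarith)
  set φ := ∑ a, J a * Real.exp (-(s * (u a - Dl))) with hφ
  have hφ0 : 0 < φ := sum_mul_exp_pos hJ _
  -- One `δ` absorbs the replacement of `J` by the nearby `H k` in the likelihood ratio; the other
  -- keeps the mean of `w` strictly below `K`.
  obtain ⟨δ, hδ, hδ2⟩ : ∃ δ, 0 < δ ∧ φ < Real.exp (-(klReal Q J + 2 * δ)) := by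
    have := (Real.log_lt_iff_lt_exp hφ0).2 hlt
    refine ⟨(-klReal Q J - Real.log φ) / 4, by linarith, ?_⟩
    rw [← Real.log_lt_iff_lt_exp hφ0]
    linarith
  set K := klReal Q J + 2 * δ with hK
  obtain ⟨ψ, hψ1, hψ2⟩ := exists_between hδ2
  have hev := eventually_half_exp_le_iidExpect hQ
    (w := fun a => Real.log (Q a / J a) + δ) (g := fun a => u a - c) (K := K) (by
      simp only [mul_add, Finset.sum_add_distrib, ← Finset.sum_mul, hQ.2]
      rw [hK, klReal]
      linarith) (Or.inl (by rw [sum_mul_sub_const hQ.2]; linarith))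
  have hlim := (tendsto_exp_mul_mul_pow (hφ0.trans hψ1).le hψ2).const_mul t
  rw [mul_zero] at hlim
  have hpos : 0 < (f c - t) / 2 := by linarith
  have hφlim : Tendsto (fun k => ∑ a, H k a * Real.exp (-(s * (u a - Dl)))) atTop (𝓝 φ) :=
    tendsto_finsetSum _ fun a _ => (hHJ' a).mul_const _
  have hHw : ∀ᶠ k in atTop, ∀ a, Q a ≤ Real.exp (Real.log (Q a / J a) + δ) * H k a := by
    rw [eventually_all]
    intro a
    rcases (hQ.1 a).eq_or_lt with h | h
    · refine Eventually.of_forall fun k => ?_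
      rw [← h]; exact mul_nonneg (Real.exp_nonneg _) ((hH k).1 a)
    · have hJa : 0 < J a := (hJ.1 a).lt_of_ne fun e => h.ne' (hac a e.symm)
      have := ((hHJ' a).const_mul (Real.exp (Real.log (Q a / J a) + δ))).eventually_const_lt
        (show Q a < Real.exp (Real.log (Q a / J a) + δ) * J a by
          rw [Real.exp_add, Real.exp_log (div_pos h hJa), mul_right_comm,
            div_mul_cancel₀ _ hJa.ne']
          exact lt_mul_of_one_lt_right h (Real.one_lt_exp_iff.2 hδ))
      filter_upwards [this] with k hk using hk.le
  obtain ⟨k, hk1, hk2, hk3, hk4, hk5⟩ := ((hN.eventually hev).and ((hN.eventually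
    (hlim.eventually_lt_const hpos)).and ((hφlim.eventually_lt_const hψ1).and
      (hHw.and (hN.eventually (eventually_gt_atTop 0)))))).exists
  set n := N k
  have hHk := hH k
  have hlower := hk1 (H k) hHk.1 hk4
  have hupper := (iidExpect_indicator_le_pow hHk.1 (fun a => u a - Dl) hs n).trans
    (pow_le_pow_left₀ (sum_mul_exp_pos hHk _).le hk3.le n)
  -- The mirror bound `f v ≥ t + (f c - t) · 1{v ≥ c} - t · 1{v ≤ Dl}`.
  have hpt : iidExpect (H k) n (fun a =>
      (t + (f c - t) * (if 0 ≤ ∑ i, (u (a i) - c) then 1 else 0)) -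
        t * (if ∑ i, (u (a i) - Dl) ≤ 0 then 1 else 0)) ≤
      iidExpect (H k) n (fun a => f ((1 / (n : ℝ)) * ∑ i, u (a i))) := by
    refine iidExpect_mono hHk.1 fun a _ => ?_
    have hav := avg_mem_Icc hk5 fun i => hu (a i)
    set v := (1 / (n : ℝ)) * ∑ i, u (a i) with hv
    have h0 := hf_nonneg _ hav
    by_cases h1 : c ≤ v
    · have := hf_mono hcI hav h1
      rw [if_pos ((le_avg_iff hk5 _ _).1 h1)]
      split_ifs <;> linarith
    · rw [if_neg (fun h => h1 ((le_avg_iff hk5 _ _).2 h))]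
      by_cases h2 : Dl < v
      · have := hmid v hav h2
        split_ifs <;> linarith
      · have : ∑ i, (u (a i) - Dl) ≤ 0 := by
          have := (avg_le_iff hk5 (fun i => u (a i)) Dl).1 (not_lt.1 h2)
          rw [Finset.sum_sub_distrib] at this ⊢
          linarith
        rw [if_pos this]
        linarith
  rw [iidExpect_sub, iidExpect_add, iidExpect_const hHk.2, iidExpect_const_mul,
    iidExpect_const_mul] at hpt
  have hexp : Real.exp (n * K) * Real.exp (-(n * K)) = 1 := by rw [← Real.exp_add]; simp
  have hfin : t * ψ ^ n < (f c - t) * (1 / 2 * Real.exp (-(n * K))) := by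
    have := mul_lt_mul_of_pos_left hk2 (Real.exp_pos (-(n * K)))
    calc t * ψ ^ n = Real.exp (-(n * K)) * (t * (Real.exp (n * K) * ψ ^ n)) := by
          linear_combination (-(t * ψ ^ n)) * hexp
      _ < _ := this
      _ = _ := by ring
  have e1 := mul_le_mul_of_nonneg_left hupper ht0
  have e2 := mul_le_mul_of_nonneg_left hlower (by linarith : 0 ≤ f c - t)
  have := hcost k
  linarith

end Cost

/-! ### Convergence of constrained minima. -/

section Limit

/-- Convergence of constrained minima over a compact set. -/
lemma exists_tendsto_min {E : Type*} [TopologicalSpace E] [FirstCountableTopology E] {M C : Set E}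
    (hM : IsCompact M) {I : E → ℝ} (hI : ContinuousOn I M) {S : ℕ → Set E} {v : ℕ → ℝ}
    (hv : ∀ n, 1 ≤ n → IsLeast (I '' (M ∩ S n)) (v n)) (hCM : C ⊆ M)
    (hconv : ∀ (N : ℕ → ℕ) (x : ℕ → E) (y : E), Tendsto N atTop atTop →
      (∀ k, x k ∈ M ∩ S (N k)) → y ∈ M → Tendsto x atTop (𝓝 y) → y ∈ C)
    (hach : ∀ y ∈ C, ∃ x : ℕ → E, Tendsto x atTop (𝓝 y) ∧
      ∀ k, x k ∈ M ∧ ∀ᶠ n in atTop, x k ∈ S n) :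
    ∃ ℓ, Tendsto v atTop (𝓝 ℓ) ∧ IsLeast (I '' C) ℓ := by
  have hx : ∀ n, ∃ x, 1 ≤ n → x ∈ M ∩ S n ∧ I x = v n := by
    intro n
    by_cases hn : 1 ≤ n
    · obtain ⟨x, hx, hxv⟩ := (hv n hn).1
      exact ⟨x, fun _ => ⟨hx, hxv⟩⟩
    -- Nothing is assumed about `v 0`, so the point chosen at index `0` is arbitrary.
    · obtain ⟨x, -⟩ := (hv 1 le_rfl).1
      exact ⟨x, fun h => absurd h hn⟩
  choose x hx using hx
  have hupper : ∀ y ∈ C, ∀ ε > 0, ∀ᶠ n in atTop, v n ≤ I y + ε := by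
    intro y hy ε hε
    obtain ⟨w, hw, hwM⟩ := hach y hy
    have hIw : Tendsto (fun k => I (w k)) atTop (𝓝 (I y)) :=
      (hI y (hCM hy)).tendsto.comp
        (tendsto_nhdsWithin_iff.2 ⟨hw, Eventually.of_forall fun k => (hwM k).1⟩)
    obtain ⟨k, hk⟩ := (hIw.eventually_lt_const (show I y < I y + ε by linarith)).exists
    filter_upwards [(hwM k).2, eventually_ge_atTop 1] with n hn hn1
    exact ((hv n hn1).2 ⟨_, ⟨(hwM k).1, hn⟩, rfl⟩).trans hk.le
  -- Along any sequence of indices, compactness makes the minimizers converge on a subsequence to a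
  -- point of `C`. With `hupper`, the value there must be the minimum over `C`.
  have hsub : ∀ N : ℕ → ℕ, Tendsto N atTop atTop → ∃ y ∈ C, ∃ θ : ℕ → ℕ, StrictMono θ ∧
      Tendsto (fun k => v (N (θ k))) atTop (𝓝 (I y)) := by
    intro N hN
    obtain ⟨k₀, hk₀⟩ := eventually_atTop.1 (hN.eventually (eventually_ge_atTop 1))
    have hN' : Tendsto (fun k => N (k + k₀)) atTop atTop := hN.comp (tendsto_add_atTop_nat k₀)
    have h1 : ∀ k, 1 ≤ N (k + k₀) := fun k => hk₀ _ (Nat.le_add_left _ _)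
    obtain ⟨y, hy, θ, hθ, hlim⟩ := hM.isSeqCompact fun k => (hx _ (h1 k)).1.1
    refine ⟨y, ?_, fun k => θ k + k₀, fun a b hab => Nat.add_lt_add_right (hθ hab) _, ?_⟩
    · exact hconv _ _ y (hN'.comp hθ.tendsto_atTop) (fun k => (hx _ (h1 (θ k))).1) hy hlim
    · have : Tendsto (fun k => I (x (N (θ k + k₀)))) atTop (𝓝 (I y)) :=
        (hI y hy).tendsto.comp (tendsto_nhdsWithin_iff.2
          ⟨hlim, Eventually.of_forall fun k => (hx _ (h1 (θ k))).1.1⟩)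
      exact this.congr fun k => (hx _ (h1 (θ k))).2
  obtain ⟨y, hy, θ, hθ, hlim⟩ := hsub id tendsto_id
  refine ⟨I y, ?_, ⟨y, hy, rfl⟩, ?_⟩
  · refine tendsto_of_subseq_tendsto fun N hN => ?_
    obtain ⟨z, hz, η, hη, hlimz⟩ := hsub N hN
    have h1 : I z ≤ I y := le_of_forall_pos_le_add fun ε hε =>
      le_of_tendsto hlimz ((hN.comp hη.tendsto_atTop).eventually (hupper y hy ε hε))
    have h2 : I y ≤ I z := le_of_forall_pos_le_add fun ε hε =>
      le_of_tendsto hlim (hθ.tendsto_atTop.eventually (hupper z hz ε hε))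
    exact ⟨η, by rw [le_antisymm h2 h1]; exact hlimz⟩
  · rintro _ ⟨z, hz, rfl⟩
    exact le_of_forall_pos_le_add fun ε hε =>
      le_of_tendsto hlim (hθ.tendsto_atTop.eventually (hupper z hz ε hε))

end Limit

/-! ### The two inverses of the cost function. -/

section Inverses
variable {f : ℝ → ℝ} {Dmin Dmax t : ℝ}

lemma invL_mem_Icc (hD : Dmin ≤ Dmax) (ht : f Dmin < t) :
    invL f Dmin Dmax t ∈ Icc Dmin Dmax :=
  ⟨le_csSup ⟨Dmax, fun _ h => h.1.2⟩ ⟨⟨le_rfl, hD⟩, ht⟩,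
    csSup_le ⟨Dmin, ⟨le_rfl, hD⟩, ht⟩ fun _ h => h.1.2⟩

lemma invL_le_invU (hD : Dmin ≤ Dmax) (ht : f Dmin < t) :
    invL f Dmin Dmax t ≤ invU f Dmin Dmax t :=
  csSup_le_csSup ⟨Dmax, fun _ h => h.1.2⟩ ⟨Dmin, ⟨le_rfl, hD⟩, ht⟩ fun _ h => ⟨h.1, h.2.le⟩

lemma lt_of_lt_invL (hf : MonotoneOn f (Icc Dmin Dmax)) (hD : Dmin ≤ Dmax) (ht : f Dmin < t)
    {D : ℝ} (hDI : D ∈ Icc Dmin Dmax) (h : D < invL f Dmin Dmax t) : f D < t := by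
  obtain ⟨D', hD', hlt⟩ := exists_lt_of_lt_csSup (by exact ⟨Dmin, ⟨le_rfl, hD⟩, ht⟩) h
  exact (hf hDI hD'.1 hlt.le).trans_lt hD'.2

lemma le_of_invL_lt {D : ℝ} (hDI : D ∈ Icc Dmin Dmax) (h : invL f Dmin Dmax t < D) : t ≤ f D := by
  by_contra! hlt
  exact h.not_ge (le_csSup ⟨Dmax, fun _ h => h.1.2⟩ ⟨hDI, hlt⟩)

lemma lt_of_invU_lt {D : ℝ} (hDI : D ∈ Icc Dmin Dmax) (h : invU f Dmin Dmax t < D) : t < f D := by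
  by_contra! hle
  exact h.not_ge (le_csSup ⟨Dmax, fun _ h => h.1.2⟩ ⟨hDI, hle⟩)

/-- Left-continuity is what includes the endpoint `D = invU f Dmin Dmax t`; below it monotonicity
suffices. -/
lemma le_of_le_invU (hf : MonotoneOn f (Icc Dmin Dmax))
    (hf_left : ∀ D ∈ Icc Dmin Dmax, ContinuousWithinAt f (Icc Dmin D) D)
    (hD : Dmin ≤ Dmax) (ht : f Dmin < t) {D : ℝ} (hDI : D ∈ Icc Dmin Dmax)
    (h : D ≤ invU f Dmin Dmax t) : f D ≤ t := by
  have hlt : ∀ D ∈ Icc Dmin Dmax, D < invU f Dmin Dmax t → f D ≤ t := by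
    intro D hDI h
    obtain ⟨D', hD', hlt⟩ := exists_lt_of_lt_csSup (by exact ⟨Dmin, ⟨le_rfl, hD⟩, ht.le⟩) h
    exact (hf hDI hD'.1 hlt.le).trans hD'.2
  rcases h.lt_or_eq with h | h
  · exact hlt D hDI h
  rcases hDI.1.eq_or_lt with hm | hm
  · rw [← hm]; exact ht.le
  have hne : (𝓝[Ico Dmin D] D).NeBot := by
    rw [← mem_closure_iff_nhdsWithin_neBot, closure_Ico hm.ne]
    exact right_mem_Icc.2 hm.le
  refine le_of_tendsto ((hf_left D hDI).mono Ico_subset_Icc_self) ?_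
  filter_upwards [self_mem_nhdsWithin] with x hx
  exact hlt x ⟨hx.1, hx.2.le.trans hDI.2⟩ (h ▸ hx.2)

end Inverses

/-! ### The exponents `R^l` and `R^u`. -/

section Exponents
variable {X Xh : Type*} [Fintype X] [Fintype Xh] {d : X → Xh → ℝ} {J : X × Xh → ℝ}

lemma Rl_le_kl {Q : X × Xh → ℝ} (hQ : Q ∈ stdSimplex ℝ (X × Xh)) {c : ℝ}
    (h : ∑ a, Q a * d a.1 a.2 ≤ c) : Rl d J c ≤ kl Q J :=
  iInf₂_le_of_le Q hQ (iInf_le _ h)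

lemma Ru_le_kl {Q : X × Xh → ℝ} (hQ : Q ∈ stdSimplex ℝ (X × Xh)) {c : ℝ}
    (h : c ≤ ∑ a, Q a * d a.1 a.2) : Ru d J c ≤ kl Q J :=
  iInf₂_le_of_le Q hQ (iInf_le _ h)

lemma Ru_mono {c c' : ℝ} (h : c ≤ c') : Ru d J c ≤ Ru d J c' :=
  le_iInf₂ fun _ hQ => le_iInf fun hc => Ru_le_kl hQ (h.trans hc)

lemma kl_self (J : X × Xh → ℝ) : kl J J = 0 := by
  rw [kl_of_ac fun _ => id, klReal_self, ENNReal.ofReal_zero]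

lemma ofReal_neg_log_le_kl (hJ : J ∈ stdSimplex ℝ (X × Xh)) {Q : X × Xh → ℝ}
    (hQ : Q ∈ stdSimplex ℝ (X × Xh)) {g : X × Xh → ℝ} (hg : ∑ a, Q a * g a ≤ 0) {s : ℝ}
    (hs : 0 ≤ s) : ENNReal.ofReal (-Real.log (∑ a, J a * Real.exp (-(s * g a)))) ≤ kl Q J := by
  by_cases htop : kl Q J = ⊤
  · rw [htop]; exact le_top
  · have hac := ac_of_kl_ne_top htop
    rw [kl_of_ac hac]
    exact ENNReal.ofReal_le_ofReal (neg_log_sum_exp_le_klReal hQ hJ hac hg hs)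

lemma ofReal_neg_log_le_Ru (hJ : J ∈ stdSimplex ℝ (X × Xh)) (c : ℝ) {s : ℝ} (hs : 0 ≤ s) :
    ENNReal.ofReal (-Real.log (∑ a, J a * Real.exp (-(s * (c - d a.1 a.2))))) ≤ Ru d J c :=
  le_iInf₂ fun Q hQ => le_iInf fun hc => ofReal_neg_log_le_kl hJ hQ (by
    rw [sum_mul_const_sub hQ.2 (fun a => d a.1 a.2)]
    exact sub_nonpos.2 hc) hs

lemma ofReal_neg_log_le_Rl (hJ : J ∈ stdSimplex ℝ (X × Xh)) (c : ℝ) {s : ℝ} (hs : 0 ≤ s) :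
    ENNReal.ofReal (-Real.log (∑ a, J a * Real.exp (-(s * (d a.1 a.2 - c))))) ≤ Rl d J c :=
  le_iInf₂ fun Q hQ => le_iInf fun hc => ofReal_neg_log_le_kl hJ hQ (by
    rw [sum_mul_sub_const hQ.2 (fun a => d a.1 a.2)]
    exact sub_nonpos.2 hc) hs

/-- If the mean exceeded `c`, Chernoff's bound would give a positive lower bound on `R^l`;
attainment of the infimum is not needed. -/
lemma sum_le_of_Rl_eq_zero (hJ : J ∈ stdSimplex ℝ (X × Xh)) {c : ℝ} (h : Rl d J c = 0) :
    ∑ a, J a * d a.1 a.2 ≤ c := by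
  by_contra! hlt
  obtain ⟨s, hs, hs1⟩ := exists_exp_sum_lt_one hJ (g := fun a => d a.1 a.2 - c)
    (by rw [sum_mul_sub_const hJ.2 (fun a => d a.1 a.2)]; linarith)
  have := ofReal_neg_log_le_Rl (d := d) hJ c hs.le
  rw [h, nonpos_iff_eq_zero, ENNReal.ofReal_eq_zero] at this
  have := Real.log_neg (sum_mul_exp_pos hJ _) hs1
  linarith

/-- A bound by `R^u(J, c)` for all `c > D` extends to constraints at `D` itself, as soon as some
letter of positive probability has distortion above `D`. -/
lemma le_kl_of_forall_le_Ru (hJ : J ∈ stdSimplex ℝ (X × Xh)) {R : ℝ≥0∞} {D : ℝ}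
    (h : ∀ c, D < c → R ≤ Ru d J c) {b : X × Xh} (hb : J b ≠ 0) (hdb : D < d b.1 b.2)
    {Q : X × Xh → ℝ} (hQ : Q ∈ stdSimplex ℝ (X × Xh)) (hac : ∀ a, J a = 0 → Q a = 0)
    (hD : D ≤ ∑ a, Q a * d a.1 a.2) : R ≤ kl Q J := by
  classical
  set δ : X × Xh → ℝ := Pi.single b 1 with hδ
  have hδm : δ ∈ stdSimplex ℝ (X × Xh) := single_mem_stdSimplex ℝ b
  have hδac : ∀ a, J a = 0 → δ a = 0 := fun a ha => by
    rw [hδ, Pi.single_eq_of_ne]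
    rintro rfl
    exact hb ha
  have hδd : ∑ a, δ a * d a.1 a.2 = d b.1 b.2 := by
    rw [Finset.sum_eq_single b]
    · simp [hδ]
    · intro a _ hab; simp [hδ, hab]
    · simp
  -- Moving mass `η` to the letter `b` pushes the mean strictly above `D`; by convexity the
  -- divergence grows at most linearly, and `η → 0` removes the excess.
  have hbound : ∀ η ∈ Ioo (0 : ℝ) 1,
      R ≤ ENNReal.ofReal ((1 - η) * klReal Q J + η * klReal δ J) := by
    intro η hη
    have hmem : (fun a => (1 - η) * Q a + η * δ a) ∈ stdSimplex ℝ (X × Xh) :=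
      convex_stdSimplex ℝ _ hQ hδm (sub_nonneg.2 hη.2.le) hη.1.le (by ring)
    have hsum : ∑ a, ((1 - η) * Q a + η * δ a) * d a.1 a.2 =
        (1 - η) * ∑ a, Q a * d a.1 a.2 + η * d b.1 b.2 := by
      rw [← hδd, Finset.mul_sum, Finset.mul_sum, ← Finset.sum_add_distrib]
      exact Finset.sum_congr rfl fun a _ => by ring
    have h1 := (h ((1 - η) * ∑ a, Q a * d a.1 a.2 + η * d b.1 b.2)
      (by nlinarith [hη.1, hη.2])).trans
      (Ru_le_kl (Q := fun a => (1 - η) * Q a + η * δ a) hmem hsum.ge)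
    rw [kl_of_ac fun a ha => by simp [hac a ha, hδac a ha]] at h1
    refine h1.trans (ENNReal.ofReal_le_ofReal ?_)
    have := klReal_mix_le hQ.1 hδm.1 hJ.1 hJ.1 hac hδac hη.1 hη.2
    have e : (fun a => (1 - η) * J a + η * J a) = J := by ext; ring
    rwa [e] at this
  rw [kl_of_ac hac]
  have hlim : Tendsto (fun η : ℝ => ENNReal.ofReal ((1 - η) * klReal Q J + η * klReal δ J))
      (𝓝[>] 0) (𝓝 (ENNReal.ofReal (klReal Q J))) := by
    have : Continuous fun η : ℝ => ENNReal.ofReal ((1 - η) * klReal Q J + η * klReal δ J) :=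
      ENNReal.continuous_ofReal.comp (by fun_prop)
    have := (this.tendsto 0).mono_left (nhdsWithin_le_nhds (s := Ioi 0))
    simpa using this
  exact ge_of_tendsto hlim (by
    filter_upwards [Ioo_mem_nhdsGT (show (0 : ℝ) < 1 by norm_num)] with η hη using hbound η hη)

/-- A strict inequality between the two exponents persists under small perturbations of the law. -/
lemma eventually_Rl_le_Ru (hJ : J ∈ stdSimplex ℝ (X × Xh)) {c c' : ℝ} (h : Rl d J c < Ru d J c')
    {ι : Type*} {l : Filter ι} {H : ι → X × Xh → ℝ} (hH : ∀ k, H k ∈ stdSimplex ℝ (X × Xh))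
    (hHJ : Tendsto H l (𝓝 J)) : ∀ᶠ k in l, Rl d (H k) c ≤ Ru d (H k) c' := by
  have hHJ' : ∀ a, Tendsto (fun k => H k a) l (𝓝 (J a)) := tendsto_pi_nhds.1 hHJ
  -- A finite level between the exponents. A strict bound on an exponential moment keeps `R^u` above
  -- it, and one fixed `Q` keeps `R^l` below it; both bounds vary continuously with the law.
  obtain ⟨r, hr1, hr2⟩ := exists_between h
  obtain ⟨K, hK⟩ : ∃ K, r = ENNReal.ofReal K :=
    ⟨r.toReal, (ENNReal.ofReal_toReal (ne_top_of_lt hr2)).symm⟩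
  rw [hK] at hr1 hr2
  have h1 : ∀ᶠ k in l, ENNReal.ofReal K ≤ Ru d (H k) c' := by
    obtain ⟨s, hs, hlt⟩ := exists_sum_exp_lt hJ (fun a => c' - d a.1 a.2) K (by
      intro Q hQ hac hg
      rw [sum_mul_const_sub hQ.2 (fun a => d a.1 a.2), sub_nonpos] at hg
      have := hr2.trans_le (Ru_le_kl (J := J) hQ hg)
      rw [kl_of_ac hac] at this
      exact (ENNReal.ofReal_lt_ofReal_iff'.1 this).1)
    have hlim : Tendsto (fun k => ∑ a, H k a * Real.exp (-(s * (c' - d a.1 a.2)))) l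
        (𝓝 (∑ a, J a * Real.exp (-(s * (c' - d a.1 a.2))))) :=
      tendsto_finsetSum _ fun a _ => (hHJ' a).mul_const _
    filter_upwards [hlim.eventually_lt_const hlt] with k hk
    refine le_trans (ENNReal.ofReal_le_ofReal ?_) (ofReal_neg_log_le_Ru (hH k) c' hs)
    have := (Real.log_lt_iff_lt_exp (sum_mul_exp_pos (hH k) _)).2 hk
    linarith
  have h2 : ∀ᶠ k in l, Rl d (H k) c ≤ ENNReal.ofReal K := by
    simp only [Rl, iInf_lt_iff] at hr1
    obtain ⟨Q, hQ, hc, hlt⟩ := hr1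
    have hac := ac_of_kl_ne_top (ne_top_of_lt hlt)
    rw [kl_of_ac hac] at hlt
    have hlim : Tendsto (fun k => klReal Q (H k)) l (𝓝 (klReal Q J)) := by
      refine tendsto_finsetSum _ fun a _ => ?_
      by_cases hQa : Q a = 0
      · simpa [hQa] using tendsto_const_nhds
      · have hJa : J a ≠ 0 := fun e => hQa (hac a e)
        exact ((tendsto_const_nhds.div (hHJ' a) hJa).log (div_ne_zero hQa hJa)).const_mul _
    have hne : ∀ᶠ k in l, ∀ a, H k a = 0 → Q a = 0 := by
      rw [eventually_all]
      intro a
      by_cases hJa : J a = 0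
      · exact Eventually.of_forall fun k _ => hac a hJa
      · filter_upwards [(hHJ' a).eventually_ne hJa] with k hk e using absurd e hk
    filter_upwards [hlim.eventually_lt_const (ENNReal.ofReal_lt_ofReal_iff'.1 hlt).1, hne]
      with k hk hk'
    refine (Rl_le_kl hQ hc).trans ?_
    rw [kl_of_ac hk']
    exact ENNReal.ofReal_le_ofReal hk.le
  filter_upwards [h1, h2] with k hk1 hk2 using hk2.trans hk1

end Exponents

/-! ### Mixing with a law of minimal distortion. -/

section Achievability
variable {A : Type*} [Fintype A] {u : A → ℝ} {Dmin Dmax : ℝ} {f : ℝ → ℝ} {t Dl Du : ℝ}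

lemma eq_of_sum_mul_le {Q : A → ℝ} (hQ : Q ∈ stdSimplex ℝ A) (hu : ∀ a, Dmin ≤ u a)
    (h : ∑ a, Q a * u a ≤ Dmin) (a : A) (ha : Q a ≠ 0) : u a = Dmin := by
  have hterm : ∀ a ∈ Finset.univ, 0 ≤ Q a * (u a - Dmin) := fun a _ =>
    mul_nonneg (hQ.1 a) (sub_nonneg.2 (hu a))
  have hsum := sum_mul_sub_const hQ.2 u Dmin
  have h0 := (Finset.sum_eq_zero_iff_of_nonneg hterm).1
    (le_antisymm (by linarith) (Finset.sum_nonneg hterm)) a (Finset.mem_univ a)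
  linarith [(mul_eq_zero.1 h0).resolve_left ha]

lemma sum_mul_eq_of_support {J₀ : A → ℝ} (hJ₀ : J₀ ∈ stdSimplex ℝ A)
    (hsupp : ∀ a, J₀ a ≠ 0 → u a = Dmin) (v : ℝ → ℝ) :
    ∑ a, J₀ a * v (u a) = v Dmin := by
  calc ∑ a, J₀ a * v (u a) = ∑ a, J₀ a * v Dmin := by
        refine Finset.sum_congr rfl fun a _ => ?_
        by_cases h : J₀ a = 0
        · simp [h]
        · rw [hsupp a h]
    _ = v Dmin := by rw [← Finset.sum_mul, hJ₀.2, one_mul]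

lemma sum_mix_mul (ε : ℝ) (J J₀ v : A → ℝ) :
    ∑ a, ((1 - ε) * J a + ε * J₀ a) * v a = (1 - ε) * ∑ a, J a * v a + ε * ∑ a, J₀ a * v a := by
  rw [Finset.mul_sum, Finset.mul_sum, ← Finset.sum_add_distrib]
  exact Finset.sum_congr rfl fun a _ => by ring

/-- Mixing a law with one of minimal distortion turns a weak comparison of exponents into
feasibility at all large block lengths. -/
lemma eventually_iidExpect_cost_mix_le (hu : ∀ a, u a ∈ Icc Dmin Dmax)
    (hf_nonneg : ∀ D ∈ Icc Dmin Dmax, 0 ≤ f D)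
    (hf_mono : MonotoneOn f (Icc Dmin Dmax)) (ht : f Dmin < t) (hDl : Dl ∈ Icc Dmin Dmax)
    (hlow : ∀ D ∈ Icc Dmin Dmax, D < Dl → f D < t)
    (hup : ∀ D ∈ Icc Dmin Dmax, D ≤ Du → f D ≤ t)
    {J J₀ Q : A → ℝ} (hJ : J ∈ stdSimplex ℝ A) (hJ₀ : J₀ ∈ stdSimplex ℝ A)
    (hsupp : ∀ a, J₀ a ≠ 0 → u a = Dmin) (hQ : Q ∈ stdSimplex ℝ A)
    (hac : ∀ a, J a = 0 → Q a = 0) (hQl : ∑ a, Q a * u a ≤ Dl) {ε : ℝ} (hε : 0 < ε) (hε1 : ε < 1)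
    {s : ℝ} (hs : 0 ≤ s)
    (hlt : ∑ a, J a * Real.exp (-(s * (Du - u a))) < Real.exp (-((1 - ε) * klReal Q J))) :
    ∀ᶠ n : ℕ in atTop, iidExpect (fun a => (1 - ε) * J a + ε * J₀ a) n
      (fun a => f ((1 / (n : ℝ)) * ∑ i, u (a i))) ≤ t := by
  have hmix : ∀ {Q : A → ℝ}, Q ∈ stdSimplex ℝ A →
      (fun a => (1 - ε) * Q a + ε * J₀ a) ∈ stdSimplex ℝ A := fun hQ =>
    convex_stdSimplex ℝ _ hQ hJ₀ (sub_nonneg.2 hε1.le) hε.le (by ring)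
  have h1ε : 0 < 1 - ε := by linarith
  refine eventually_iidExpect_cost_le (Q := fun a => (1 - ε) * Q a + ε * J₀ a) hu hf_nonneg
    hf_mono ht hDl.2 hlow hup (hmix hJ) (hmix hQ) ?_ ?_ hs ?_
  · intro a ha
    have p1 := mul_nonneg h1ε.le (hJ.1 a)
    have p2 := mul_nonneg hε.le (hJ₀.1 a)
    have e1 : (1 - ε) * J a = 0 := by linarith
    have e2 : ε * J₀ a = 0 := by linarith
    rw [e2, hac a ((mul_eq_zero.1 e1).resolve_left h1ε.ne')]
    ring
  · rcases hDl.1.eq_or_lt with h | h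
    · right
      intro a ha
      by_cases h0 : J₀ a = 0
      · refine eq_of_sum_mul_le hQ (fun a => (hu a).1) (hQl.trans h.ge) a fun hz => ha ?_
        simp [h0, hz]
      · exact hsupp a h0
    · left
      rw [sum_mix_mul, sum_mul_eq_of_support hJ₀ hsupp fun x => x]
      nlinarith
  -- At `Dmin` the exponential takes its least value, so mixing does not raise the moment, while
  -- convexity shrinks the divergence by the factor `1 - ε`.
  · rw [sum_mix_mul, sum_mul_eq_of_support hJ₀ hsupp fun x => Real.exp (-(s * (Du - x)))]
    have hφ : Real.exp (-(s * (Du - Dmin))) ≤ ∑ a, J a * Real.exp (-(s * (Du - u a))) := by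
      calc _ = ∑ a, J a * Real.exp (-(s * (Du - Dmin))) := by
            rw [← Finset.sum_mul, hJ.2, one_mul]
        _ ≤ _ := Finset.sum_le_sum fun a _ => mul_le_mul_of_nonneg_left
            (Real.exp_le_exp.2 (by nlinarith [(hu a).1])) (hJ.1 a)
    have hkl := klReal_mix_le hQ.1 hJ₀.1 hJ.1 hJ₀.1 hac (fun _ => id) hε hε1
    rw [klReal_self, mul_zero, add_zero] at hkl
    have := Real.exp_le_exp.2 (neg_le_neg hkl)
    nlinarith

end Achievability

/-! ### Perturbing mechanisms. -/

section Mechanisms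
variable {X Y Xh : Type*} [Fintype X] [Fintype Y] [Fintype Xh]
  {P : X × Y → ℝ} {d : X → Xh → ℝ} {Dmin Dmax : ℝ} {f : ℝ → ℝ} {t Dl Du : ℝ}

lemma exists_tendsto_mix {W W₀ : X × Y → Xh → ℝ} (hW : IsMechanism W) (hW₀ : IsMechanism W₀)
    (h : ∀ ε ∈ Ioo (0 : ℝ) 1, ∀ᶠ n in atTop, Feasible P d f t n (mix ε W W₀)) :
    ∃ x : ℕ → X × Y → Xh → ℝ, Tendsto x atTop (𝓝 W) ∧
      ∀ k, IsMechanism (x k) ∧ ∀ᶠ n in atTop, Feasible P d f t n (x k) := by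
  have hpos : ∀ k : ℕ, 1 / ((k : ℝ) + 2) ∈ Ioo (0 : ℝ) 1 := fun k => by
    have : (0 : ℝ) ≤ k := k.cast_nonneg
    refine ⟨by positivity, ?_⟩
    rw [div_lt_one (by positivity)]
    linarith
  refine ⟨fun k => mix (1 / ((k : ℝ) + 2)) W W₀, ?_, fun k =>
    ⟨isMechanism_mix hW hW₀ (hpos k).1.le (hpos k).2.le, h _ (hpos k)⟩⟩
  have hlim : Tendsto (fun k : ℕ => 1 / ((k : ℝ) + 2)) atTop (𝓝 0) := by
    have := (tendsto_natCast_atTop_atTop (R := ℝ)).atTop_add (tendsto_const_nhds (x := (2 : ℝ)))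
    simp only [one_div]
    exact this.inv_tendsto_atTop
  have := ((continuous_mix W W₀).tendsto 0).comp hlim
  rwa [mix_zero] at this

/-- The mechanisms whose exponent for low distortions is at most the one for distortions above
`Du`. -/
def exponentMechanisms (P : X × Y → ℝ) (d : X → Xh → ℝ) (Dl Du : ℝ) : Set (X × Y → Xh → ℝ) :=
  {W | IsMechanism W ∧ ∀ c, Du < c → Rl d (jointX P W) Dl ≤ Ru d (jointX P W) c}

lemma eventually_feasible_mix (hP : P ∈ stdSimplex ℝ (X × Y))
    (hd : ∀ x z, d x z ∈ Icc Dmin Dmax) (hf_nonneg : ∀ D ∈ Icc Dmin Dmax, 0 ≤ f D)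
    (hf_mono : MonotoneOn f (Icc Dmin Dmax)) (ht : f Dmin < t) (hDl : Dl ∈ Icc Dmin Dmax)
    (hlu : Dl < Du) (hlow : ∀ D ∈ Icc Dmin Dmax, D < Dl → f D < t)
    (hup : ∀ D ∈ Icc Dmin Dmax, D ≤ Du → f D ≤ t) {W W₀ : X × Y → Xh → ℝ}
    (hW₀ : IsMechanism W₀) (hW₀d : ∀ a, jointX P W₀ a ≠ 0 → d a.1 a.2 = Dmin)
    (hW : W ∈ exponentMechanisms P d Dl Du) {ε : ℝ} (hε : ε ∈ Ioo (0 : ℝ) 1) :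
    ∀ᶠ n in atTop, Feasible P d f t n (mix ε W W₀) := by
  obtain ⟨hWm, hWc⟩ := hW
  have hJ := jointX_mem_stdSimplex hP hWm
  have hJ₀ := jointX_mem_stdSimplex hP hW₀
  have hH := jointX_mem_stdSimplex hP (isMechanism_mix hWm hW₀ hε.1.le hε.2.le)
  simp only [Feasible]
  rw [jointX_mix] at hH ⊢
  set J := jointX P W with hJdef
  set J₀ := jointX P W₀ with hJ₀def
  have hu : ∀ a : X × Xh, d a.1 a.2 ∈ Icc Dmin Dmax := fun a => hd _ _
  -- Without letters above `Du` the cost never exceeds `t`. Otherwise such a letter lets the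
  -- comparison for all `c > Du` extend to `Du`.
  by_cases hsupp : ∀ a, J a ≠ 0 → d a.1 a.2 ≤ Du
  · filter_upwards [eventually_gt_atTop 0] with n hn
    refine iidExpect_cost_le_of_support (u := fun a : X × Xh => d a.1 a.2) hu hH hup ?_ hn
    intro a ha
    by_cases h0 : J₀ a = 0
    · exact hsupp a fun hz => ha (by simp [h0, hz])
    · exact (hW₀d a h0).trans_le (hDl.1.trans hlu.le)
  push Not at hsupp
  obtain ⟨b, hb, hdb⟩ := hsupp
  have hall : ∀ Q ∈ stdSimplex ℝ (X × Xh), (∀ a, J a = 0 → Q a = 0) →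
      ∑ a, Q a * (Du - d a.1 a.2) ≤ 0 → Rl d J Dl ≤ ENNReal.ofReal (klReal Q J) := by
    intro Q hQ hac hg
    rw [sum_mul_const_sub hQ.2 (fun a => d a.1 a.2), sub_nonpos] at hg
    rw [← kl_of_ac hac]
    exact le_kl_of_forall_le_Ru hJ hWc hb hdb hQ hac hg
  have happly := fun (Q : X × Xh → ℝ) hQ hac hQl (s : ℝ) hs hlt =>
    eventually_iidExpect_cost_mix_le (u := fun a : X × Xh => d a.1 a.2) (Q := Q) (s := s) hu
      hf_nonneg hf_mono ht hDl hlow hup hJ hJ₀ hW₀d hQ hac hQl hε.1 hε.2 hs hlt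
  by_cases hR0 : Rl d J Dl = 0
  · have hE := sum_le_of_Rl_eq_zero hJ hR0
    obtain ⟨s, hs, hs1⟩ := exists_exp_sum_lt_one hJ (g := fun a => Du - d a.1 a.2)
      (by rw [sum_mul_const_sub hJ.2 (fun a => d a.1 a.2)]; linarith)
    exact happly J hJ (fun _ => id) hE s hs.le (by simpa [klReal_self] using hs1)
  have hRtop : Rl d J Dl ≠ ⊤ := by
    classical
    have hδm : (Pi.single b 1 : X × Xh → ℝ) ∈ stdSimplex ℝ (X × Xh) := single_mem_stdSimplex ℝ b
    refine ne_top_of_le_ne_top ENNReal.ofReal_ne_top (hall _ hδm (fun a ha => ?_) ?_)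
    · rw [Pi.single_eq_of_ne]
      rintro rfl
      exact hb ha
    · refine Finset.sum_nonpos fun a _ => ?_
      by_cases hab : a = b
      · subst hab; simpa using hdb.le
      · simp [hab]
  set R := (Rl d J Dl).toReal with hR
  have hRpos : 0 < R := ENNReal.toReal_pos hR0 hRtop
  have hRof : Rl d J Dl = ENNReal.ofReal R := (ENNReal.ofReal_toReal hRtop).symm
  have hε0 := hε.1
  -- The gain `1 - ε` leaves room to approximate both exponents within `ε / 2`, since `(1 - ε) (1 +
  -- ε / 2) ≤ 1 - ε / 2`.
  obtain ⟨s, hs, hlt⟩ := exists_sum_exp_lt hJ (fun a => Du - d a.1 a.2) ((1 - ε / 2) * R) (by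
    intro Q hQ hac hg
    have := hall Q hQ hac hg
    rw [hRof, ENNReal.ofReal_le_ofReal_iff'] at this
    rcases this with h | h <;> nlinarith)
  have hlt' : Rl d J Dl < ENNReal.ofReal ((1 + ε / 2) * R) := by
    rw [hRof, ENNReal.ofReal_lt_ofReal_iff']
    constructor <;> nlinarith
  rw [Rl] at hlt'
  simp only [iInf_lt_iff] at hlt'
  obtain ⟨Q, hQ, hc, hQlt⟩ := hlt'
  have hac := ac_of_kl_ne_top (ne_top_of_lt hQlt)
  rw [kl_of_ac hac] at hQlt
  have hklt := (ENNReal.ofReal_lt_ofReal_iff'.1 hQlt).1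
  refine happly Q hQ hac hc s hs (hlt.trans_le (Real.exp_le_exp.2 (neg_le_neg ?_)))
  calc (1 - ε) * klReal Q J ≤ (1 - ε) * ((1 + ε / 2) * R) :=
        mul_le_mul_of_nonneg_left hklt.le (by linarith [hε.2])
    _ ≤ (1 - ε / 2) * R := by nlinarith [mul_pos hε0 hRpos, mul_pos hε0 (mul_pos hε0 hRpos)]

/-- Mixing brings the mean strictly below `Dl`, where the mixed law itself serves as `Q` with
divergence zero. If `Dl = Dmin`, all the mass already sits at `Dmin`. -/
lemma eventually_feasible_mix_of_expect_le (hP : P ∈ stdSimplex ℝ (X × Y))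
    (hd : ∀ x z, d x z ∈ Icc Dmin Dmax) (hf_nonneg : ∀ D ∈ Icc Dmin Dmax, 0 ≤ f D)
    (hf_mono : MonotoneOn f (Icc Dmin Dmax)) (ht : f Dmin < t) (hDl : Dl ∈ Icc Dmin Dmax)
    (hlow : ∀ D ∈ Icc Dmin Dmax, D < Dl → f D < t)
    (hup : ∀ D ∈ Icc Dmin Dmax, D ≤ Dl → f D ≤ t) {W W₀ : X × Y → Xh → ℝ}
    (hW₀ : IsMechanism W₀) (hW₀d : ∀ a, jointX P W₀ a ≠ 0 → d a.1 a.2 = Dmin)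
    (hW : IsMechanism W) (hE : ∑ a, jointX P W a * d a.1 a.2 ≤ Dl) {ε : ℝ}
    (hε : ε ∈ Ioo (0 : ℝ) 1) :
    ∀ᶠ n in atTop, Feasible P d f t n (mix ε W W₀) := by
  have hJ := jointX_mem_stdSimplex hP hW
  have hJ₀ := jointX_mem_stdSimplex hP hW₀
  have hH := jointX_mem_stdSimplex hP (isMechanism_mix hW hW₀ hε.1.le hε.2.le)
  simp only [Feasible]
  rw [jointX_mix] at hH ⊢
  set J := jointX P W with hJdef
  set J₀ := jointX P W₀ with hJ₀def
  have hu : ∀ a : X × Xh, d a.1 a.2 ∈ Icc Dmin Dmax := fun a => hd _ _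
  rcases hDl.1.eq_or_lt with h | h
  · filter_upwards [eventually_gt_atTop 0] with n hn
    refine iidExpect_cost_le_of_support (u := fun a : X × Xh => d a.1 a.2) hu hH hup ?_ hn
    intro a ha
    by_cases h0 : J₀ a = 0
    · have := eq_of_sum_mul_le (u := fun a : X × Xh => d a.1 a.2) hJ (fun a => (hu a).1)
        (hE.trans h.ge) a fun hz => ha (by simp [h0, hz])
      exact this.trans_le hDl.1
    · exact (hW₀d a h0).trans_le hDl.1
  · have hlt : ∑ a, ((1 - ε) * J a + ε * J₀ a) * d a.1 a.2 < Dl := by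
      rw [sum_mix_mul ε J J₀ fun a => d a.1 a.2,
        sum_mul_eq_of_support (u := fun a : X × Xh => d a.1 a.2) hJ₀ hW₀d fun x => x]
      nlinarith [hε.1, hε.2]
    obtain ⟨s, hs, hs1⟩ := exists_exp_sum_lt_one hH (g := fun a => Dl - d a.1 a.2)
      (by rw [sum_mul_const_sub hH.2 (fun a => d a.1 a.2)]; linarith)
    exact eventually_iidExpect_cost_le (u := fun a : X × Xh => d a.1 a.2) hu hf_nonneg hf_mono ht
      hDl.2 hlow hup hH hH (fun _ => id) (Or.inl hlt) hs.le (by simpa [klReal_self] using hs1)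

/-- Under `L(D) > 0`, a mechanism with `R^l < R^u` at `D` can be modified to leak strictly less
while keeping `R^l ≤ R^u`. -/
lemma exists_mutualInfo_lt_of_Rl_lt_Ru (hP : P ∈ stdSimplex ℝ (X × Y)) {W : X × Y → Xh → ℝ}
    (hW : IsMechanism W) (hlt : Rl d (jointX P W) Dl < Ru d (jointX P W) Du)
    (hpos : 0 < mutualInfo (jointY P W)) :
    ∃ W', IsMechanism W' ∧ Rl d (jointX P W') Dl ≤ Ru d (jointX P W') Du ∧
      mutualInfo (jointY P W') < mutualInfo (jointY P W) := by
  set K := jointY P W with hKdef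
  have hK : K ∈ stdSimplex ℝ (Y × Xh) := jointY_mem_stdSimplex hP hW
  -- This mechanism ignores its input and reproduces the output law of `W`, so its joint law with
  -- `Y` is the product of the marginals of `K`.
  set W₁ : X × Y → Xh → ℝ := fun _ z => ∑ y, K (y, z) with hW₁
  have hW₁m : IsMechanism W₁ := fun _ => ⟨fun z => Finset.sum_nonneg fun y _ => hK.1 _, by
    rw [← hK.2, Fintype.sum_prod_type_right]⟩
  have hKW₁ : jointY P W₁ = fun p => (∑ z, K (p.1, z)) * ∑ y, K (y, p.2) := by
    ext p
    have : ∑ z, K (p.1, z) = ∑ x, P (x, p.1) := by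
      simp only [hKdef, jointY]
      rw [Finset.sum_comm]
      refine Finset.sum_congr rfl fun x _ => ?_
      rw [← Finset.mul_sum, (hW (x, p.1)).2, mul_one]
    rw [this, jointY, Finset.sum_mul]
  -- The weights range over a subtype because the stability lemma requires every law of the family
  -- to lie in the simplex.
  have hlim : Tendsto (fun ε : ↥(Ioo (0 : ℝ) 1) => jointX P (mix ε.1 W W₁))
      (comap Subtype.val (𝓝[>] 0)) (𝓝 (jointX P W)) := by
    have := (((continuous_jointX P).comp (continuous_mix W W₁)).tendsto 0).mono_left
      (nhdsWithin_le_nhds (s := Ioi 0))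
    simp only [Function.comp_apply, mix_zero] at this
    exact this.comp tendsto_comap
  have hne : (comap (Subtype.val : ↥(Ioo (0 : ℝ) 1) → ℝ) (𝓝[>] 0)).NeBot :=
    comap_neBot fun s hs => by
      obtain ⟨x, hx1, hx2⟩ := (inter_mem hs
        (Ioo_mem_nhdsGT (show (0 : ℝ) < 1 by norm_num)) |> Filter.nonempty_of_mem)
      exact ⟨⟨x, hx2⟩, hx1⟩
  obtain ⟨⟨ε, hε⟩, h⟩ := (eventually_Rl_le_Ru (jointX_mem_stdSimplex hP hW) hlt
    (fun ε : ↥(Ioo (0 : ℝ) 1) =>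
      jointX_mem_stdSimplex hP (isMechanism_mix hW hW₁m ε.2.1.le ε.2.2.le)) hlim).exists
  refine ⟨mix ε W W₁, isMechanism_mix hW hW₁m hε.1.le hε.2.le, h, ?_⟩
  have := mutualInfo_mix_marginals_le hK hε.1 hε.2
  rw [jointY_mix, hKW₁]
  refine this.trans_lt ?_
  nlinarith [hε.1]

/-- If no letter of positive probability lay above `Du`, an absolutely continuous `Q` with mean at
least `Du` would live on letters of distortion exactly `Du`, which are excluded. So some letter lies
above `Du`, and the comparison extends to the endpoint. -/
lemma le_Ru_iff_of_ne (hP : P ∈ stdSimplex ℝ (X × Y))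
    (hne : ∀ x z, 0 < ∑ y, P (x, y) → d x z ≠ Du) {W : X × Y → Xh → ℝ} (hW : IsMechanism W)
    (R : ℝ≥0∞) :
    R ≤ Ru d (jointX P W) Du ↔ ∀ c, Du < c → R ≤ Ru d (jointX P W) c := by
  have hJ := jointX_mem_stdSimplex hP hW
  refine ⟨fun h c hc => h.trans (Ru_mono hc.le), fun h => ?_⟩
  refine le_iInf₂ fun Q hQ => le_iInf fun hc => ?_
  by_cases htop : kl Q (jointX P W) = ⊤
  · rw [htop]; exact le_top
  have hac := ac_of_kl_ne_top htop
  obtain ⟨b, hb, hdb⟩ : ∃ b, jointX P W b ≠ 0 ∧ Du < d b.1 b.2 := by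
    by_contra! hcon
    have hterm : ∀ a ∈ Finset.univ, 0 ≤ Q a * (Du - d a.1 a.2) := by
      intro a _
      by_cases ha : jointX P W a = 0
      · simp [hac a ha]
      · exact mul_nonneg (hQ.1 a) (sub_nonneg.2 (hcon a ha))
    have hsum := sum_mul_const_sub hQ.2 (fun a : X × Xh => d a.1 a.2) Du
    have hz := (Finset.sum_eq_zero_iff_of_nonneg hterm).1 (le_antisymm
      (hsum.trans_le (sub_nonpos.2 hc)) (Finset.sum_nonneg hterm))
    have hQ0 : ∀ a, Q a = 0 := by
      intro a
      by_contra hQa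
      have hJa : jointX P W a ≠ 0 := fun e => hQa (hac a e)
      refine hne a.1 a.2 (sum_pos_of_jointX_ne_zero hP hJa) ?_
      linarith [(mul_eq_zero.1 (hz a (Finset.mem_univ a))).resolve_left hQa]
    have := hQ.2
    simp [hQ0] at this
  exact le_kl_of_forall_le_Ru hJ h hb hdb hQ hac hc

end Mechanisms

/-! ### Assembling the limit theorem. -/

section Main
variable {X Y Xh : Type*} [Fintype X] [Fintype Y] [Fintype Xh]
  {P : X × Y → ℝ} {d : X → Xh → ℝ} {Dmin Dmax : ℝ} {f : ℝ → ℝ} {t Dl Du : ℝ}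

/-- The limit of the minimal leakages, given which limits of feasible mechanisms occur and which
mechanisms can be perturbed to feasible ones. -/
lemma exists_tendsto_LM (hP : P ∈ stdSimplex ℝ (X × Y))
    (hLM : ∀ n, 1 ≤ n → IsLeast (memorylessLeakages P d f t n) (LM P d f t n))
    {C : Set (X × Y → Xh → ℝ)} (hCM : ∀ W ∈ C, IsMechanism W)
    (hconv : ∀ (N : ℕ → ℕ) (w : ℕ → X × Y → Xh → ℝ) (W : X × Y → Xh → ℝ), Tendsto N atTop atTop →
      (∀ k, IsMechanism (w k) ∧ Feasible P d f t (N k) (w k)) → IsMechanism W →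
      Tendsto w atTop (𝓝 W) → W ∈ C)
    {W₀ : X × Y → Xh → ℝ} (hW₀ : IsMechanism W₀)
    (hach : ∀ W ∈ C, ∀ ε ∈ Ioo (0 : ℝ) 1, ∀ᶠ n in atTop, Feasible P d f t n (mix ε W W₀)) :
    ∃ ℓ, Tendsto (fun n => LM P d f t n) atTop (𝓝 ℓ) ∧
      IsLeast ((fun W => mutualInfo (jointY P W)) '' C) ℓ := by
  refine exists_tendsto_min (M := {W | IsMechanism W}) (S := fun n => {W | Feasible P d f t n W})
    isCompact_setOf_isMechanism (continuousOn_mutualInfo_jointY hP) (fun n hn => ?_) hCM hconv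
    fun W hW => exists_tendsto_mix (hCM W hW) hW₀ (hach W hW)
  have := hLM n hn
  rwa [memorylessLeakages_eq hP d f t hn] at this

lemma image_setOf_mechanism (c : (X × Y → Xh → ℝ) → Prop) :
    (fun W => mutualInfo (jointY P W)) '' {W | IsMechanism W ∧ c W} =
      {r | ∃ W : X × Y → Xh → ℝ, IsMechanism W ∧ c W ∧ r = mutualInfo (jointY P W)} := by
  ext r
  constructor
  · rintro ⟨W, ⟨hW, h⟩, rfl⟩
    exact ⟨W, hW, h, rfl⟩
  · rintro ⟨W, hW, h, rfl⟩
    exact ⟨W, ⟨hW, h⟩, rfl⟩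

/-- Under `L(D) > 0`, the minimum over `R^l ≤ R^u` is taken at equality. -/
lemma isLeast_of_Rl_eq_Ru (hP : P ∈ stdSimplex ℝ (X × Y)) {ℓ : ℝ}
    (h : IsLeast {r | ∃ W : X × Y → Xh → ℝ, IsMechanism W ∧
      Rl d (jointX P W) Dl ≤ Ru d (jointX P W) Du ∧ r = mutualInfo (jointY P W)} ℓ)
    (hL : IsLeast (singleLetterLeakages P d Du) (L P d Du)) (hpos : 0 < L P d Du) :
    IsLeast {r | ∃ W : X × Y → Xh → ℝ, IsMechanism W ∧
      Rl d (jointX P W) Dl = Ru d (jointX P W) Du ∧ r = mutualInfo (jointY P W)} ℓ := by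
  refine ⟨?_, fun r ⟨W, hW, hWe, hr⟩ => h.2 ⟨W, hW, hWe.le, hr⟩⟩
  obtain ⟨W, hW, hle, hr⟩ := h.1
  refine ⟨W, hW, hle.antisymm ?_, hr⟩
  by_contra! hlt
  -- A mean above `Du` would make `R^u` zero, leaving no room for `R^l` below it. Hence the leakage
  -- is at least `L P d Du > 0`.
  have hE : ∑ a, jointX P W a * d a.1 a.2 ≤ Du := by
    by_contra! hE
    have := Ru_le_kl (J := jointX P W) (jointX_mem_stdSimplex hP hW) hE.le
    rw [kl_self] at this
    exact not_lt_bot (hlt.trans_le this)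
  obtain ⟨W', hW', hle', hlt'⟩ := exists_mutualInfo_lt_of_Rl_lt_Ru hP hW hlt
    (hpos.trans_le (hL.2 ⟨W, hW, hE, rfl⟩))
  exact (h.2 ⟨W', hW', hle', rfl⟩).not_gt (hr ▸ hlt')

end Main

end Leakage

open Leakage in
theorem theorem1 {X Y Xh : Type*} [Fintype X] [Fintype Y] [Fintype Xh]
    -- the source distribution `P_{X,Y}`
    (P : X × Y → ℝ) (hP : P ∈ stdSimplex ℝ (X × Y))
    -- the distortion measure, with values in `[Dmin, Dmax]`
    (d : X → Xh → ℝ) (Dmin Dmax : ℝ) (hd : ∀ x z, d x z ∈ Icc Dmin Dmax)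
    -- every source symbol of positive probability can be reproduced with distortion `Dmin`
    (hDmin : ∀ x, 0 < ∑ y, P (x, y) → ∃ z, d x z = Dmin)
    -- the cost function: nonnegative, non-decreasing, left-continuous on `[Dmin, Dmax]`
    (f : ℝ → ℝ) (hf_nonneg : ∀ D ∈ Icc Dmin Dmax, 0 ≤ f D)
    (hf_mono : MonotoneOn f (Icc Dmin Dmax))
    (hf_left : ∀ D ∈ Icc Dmin Dmax, ContinuousWithinAt f (Icc Dmin D) D)
    (t : ℝ) (ht : f Dmin < t) :
    -- the minima that define `L^{(M)}(n, t, f)` and `L(D)` exist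
    (∀ n : ℕ, 1 ≤ n →
      IsLeast (Leakage.memorylessLeakages P d f t n) (Leakage.LM P d f t n)) ∧
    (∀ D : ℝ, Dmin ≤ D →
      IsLeast (Leakage.singleLetterLeakages P d D) (Leakage.L P d D)) ∧
    -- thresholds outside `T_f`, where `f⁻¹(t) = f_l⁻¹(t) = f_u⁻¹(t)`
    (t ∉ Leakage.flatLevels f Dmin Dmax →
      Tendsto (fun n : ℕ => Leakage.LM P d f t n) atTop
        (𝓝 (Leakage.L P d (Leakage.invL f Dmin Dmax t)))) ∧
    -- thresholds in `T_f`
    (t ∈ Leakage.flatLevels f Dmin Dmax →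
      ∃ ℓ : ℝ, Tendsto (fun n : ℕ => Leakage.LM P d f t n) atTop (𝓝 ℓ) ∧
        -- `f_u⁻¹(t)` is not a single-letter distortion value
        ((∀ x z, 0 < ∑ y, P (x, y) → d x z ≠ Leakage.invU f Dmin Dmax t) →
          IsLeast {r | ∃ W : X × Y → Xh → ℝ, Leakage.IsMechanism W ∧
            Leakage.Rl d (Leakage.jointX P W) (Leakage.invL f Dmin Dmax t) ≤
              Leakage.Ru d (Leakage.jointX P W) (Leakage.invU f Dmin Dmax t) ∧
            r = Leakage.mutualInfo (Leakage.jointY P W)} ℓ ∧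
          (0 < Leakage.L P d (Leakage.invU f Dmin Dmax t) →
            IsLeast {r | ∃ W : X × Y → Xh → ℝ, Leakage.IsMechanism W ∧
              Leakage.Rl d (Leakage.jointX P W) (Leakage.invL f Dmin Dmax t) =
                Leakage.Ru d (Leakage.jointX P W) (Leakage.invU f Dmin Dmax t) ∧
              r = Leakage.mutualInfo (Leakage.jointY P W)} ℓ)) ∧
        -- in general: the exponent `R^u` is taken at all `c > f_u⁻¹(t)`
        IsLeast {r | ∃ W : X × Y → Xh → ℝ, Leakage.IsMechanism W ∧
          (∀ c, Leakage.invU f Dmin Dmax t < c →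
            Leakage.Rl d (Leakage.jointX P W) (Leakage.invL f Dmin Dmax t) ≤
              Leakage.Ru d (Leakage.jointX P W) c) ∧
          r = Leakage.mutualInfo (Leakage.jointY P W)} ℓ) := by
  have hne : Nonempty (X × Xh) := by
    by_contra hcon
    have h0 : ∀ p, P p = 0 := fun p => by
      by_contra hp
      have : 0 < ∑ y, P (p.1, y) := ((hP.1 p).lt_of_ne fun e => hp e.symm).trans_le
        (Finset.single_le_sum (f := fun y => P (p.1, y)) (fun _ _ => hP.1 _) (Finset.mem_univ p.2))
      exact hcon ⟨(p.1, (hDmin _ this).choose)⟩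
    have := hP.2
    simp [h0] at this
  have hDD : Dmin ≤ Dmax := (hd hne.some.1 hne.some.2).1.trans (hd hne.some.1 hne.some.2).2
  have ht0 : 0 ≤ t := (hf_nonneg Dmin ⟨le_rfl, hDD⟩).trans ht.le
  have hu : ∀ a : X × Xh, d a.1 a.2 ∈ Icc Dmin Dmax := fun a => hd _ _
  have hDl := invL_mem_Icc hDD ht
  have hlu := invL_le_invU hDD ht
  set Dl := invL f Dmin Dmax t with hDldef
  set Du := invU f Dmin Dmax t with hDudef
  have hlow : ∀ D ∈ Icc Dmin Dmax, D < Dl → f D < t := fun D hD => lt_of_lt_invL hf_mono hDD ht hD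
  have hmid : ∀ D ∈ Icc Dmin Dmax, Dl < D → t ≤ f D := fun D hD => le_of_invL_lt hD
  have hhigh : ∀ D ∈ Icc Dmin Dmax, Du < D → t < f D := fun D hD => lt_of_invU_lt hD
  have hup : ∀ D ∈ Icc Dmin Dmax, D ≤ Du → f D ≤ t := fun D hD =>
    le_of_le_invU hf_mono hf_left hDD ht hD
  obtain ⟨W₀, hW₀, hW₀d⟩ := exists_mechanism_eq_min hP hDmin
  have hLM : ∀ n : ℕ, 1 ≤ n → IsLeast (memorylessLeakages P d f t n) (LM P d f t n) := by
    intro n hn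
    refine isLeast_memorylessLeakages hP hn hW₀ ?_
    exact iidExpect_cost_le_of_support (u := fun a : X × Xh => d a.1 a.2) hu
      (jointX_mem_stdSimplex hP hW₀) hup (fun a ha => (hW₀d a ha).trans_le (hDl.1.trans hlu)) hn
  have hL : ∀ D : ℝ, Dmin ≤ D → IsLeast (singleLetterLeakages P d D) (L P d D) := by
    intro D hD
    refine isLeast_singleLetterLeakages hP hW₀ ?_
    exact (sum_mul_eq_of_support (u := fun a : X × Xh => d a.1 a.2) (jointX_mem_stdSimplex hP hW₀)
      hW₀d fun x => x).trans_le hD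
  -- the exponent comparison satisfied by limits of feasible mechanisms
  have hlimit : ∀ (N : ℕ → ℕ) (w : ℕ → X × Y → Xh → ℝ) (W : X × Y → Xh → ℝ),
      Tendsto N atTop atTop → (∀ k, IsMechanism (w k) ∧ Feasible P d f t (N k) (w k)) →
      IsMechanism W → Tendsto w atTop (𝓝 W) → ∀ Q ∈ stdSimplex ℝ (X × Xh),
      (∀ a, jointX P W a = 0 → Q a = 0) → Du < ∑ a, Q a * d a.1 a.2 → ∀ s : ℝ, 0 ≤ s →
      Real.exp (-klReal Q (jointX P W)) ≤
        ∑ a, jointX P W a * Real.exp (-(s * (d a.1 a.2 - Dl))) := by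
    intro N w W hN hw hW hlim Q hQ hac hQu s hs
    exact exp_neg_klReal_le_of_cost_le (u := fun a : X × Xh => d a.1 a.2) hu hf_nonneg hf_mono hmid
      hhigh (hDl.1.trans hlu) ht0 (fun k => jointX_mem_stdSimplex hP (hw k).1)
      (jointX_mem_stdSimplex hP hW) (((continuous_jointX P).tendsto W).comp hlim) hN
      (fun k => (hw k).2) hQ hac hQu hs
  refine ⟨hLM, hL, fun htT => ?_, fun htT => ?_⟩
  · have heq : Dl = Du := by
      by_contra hcon
      exact htT ⟨ht, hcon⟩
    obtain ⟨ℓ, hℓ, hleast⟩ := exists_tendsto_LM hP hLM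
      (C := {W | IsMechanism W ∧ expect (jointX P W) (fun p => d p.1 p.2) ≤ Dl})
      (fun W hW => hW.1) (fun N w W hN hw hW hlim => ⟨hW, by
        by_contra! hE
        have hE : Dl < ∑ a, jointX P W a * d a.1 a.2 := hE
        have hJ := jointX_mem_stdSimplex hP hW
        obtain ⟨s, hs, hs1⟩ := exists_exp_sum_lt_one hJ (g := fun a => d a.1 a.2 - Dl)
          (by rw [sum_mul_sub_const hJ.2 (fun a => d a.1 a.2)]; linarith)
        -- With `Q` equal to the law itself the divergence is zero, so the moment would be at least
        -- `1`, against the choice of `s`.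
        have := hlimit N w W hN hw hW hlim _ hJ (fun _ => id) (heq ▸ hE) s hs.le
        rw [klReal_self, neg_zero, Real.exp_zero] at this
        linarith⟩) hW₀
      (fun W hW ε hε => eventually_feasible_mix_of_expect_le hP hd hf_nonneg hf_mono ht hDl hlow
        (fun D hD h => hup D hD (heq ▸ h)) hW₀ hW₀d hW.1 hW.2 hε)
    rw [image_setOf_mechanism] at hleast
    rwa [(hL Dl hDl.1).unique hleast]
  · have hlt : Dl < Du := hlu.lt_of_ne htT.2
    obtain ⟨ℓ, hℓ, hleast⟩ := exists_tendsto_LM hP hLM (C := exponentMechanisms P d Dl Du)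
      (fun W hW => hW.1) (fun N w W hN hw hW hlim => ⟨hW, fun c hc => by
        refine le_iInf₂ fun Q hQ => le_iInf fun hQc => ?_
        by_cases htop : kl Q (jointX P W) = ⊤
        · rw [htop]; exact le_top
        have hac := ac_of_kl_ne_top htop
        by_contra! hcon
        rw [kl_of_ac hac] at hcon
        have hJ := jointX_mem_stdSimplex hP hW
        -- If `R^l` exceeded the divergence of `Q`, duality would give a moment below `exp (-klReal
        -- Q J)`, contradicting `hlimit`.
        obtain ⟨s, hs, hs1⟩ := exists_sum_exp_lt hJ (fun a => d a.1 a.2 - Dl)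
          (klReal Q (jointX P W)) (by
            intro Q' hQ' hac' hg
            rw [sum_mul_sub_const hQ'.2 (fun a => d a.1 a.2), sub_nonpos] at hg
            have := hcon.trans_le (Rl_le_kl hQ' hg)
            rw [kl_of_ac hac'] at this
            exact (ENNReal.ofReal_lt_ofReal_iff'.1 this).1)
        exact (hlimit N w W hN hw hW hlim Q hQ hac (hc.trans_le hQc) s hs).not_gt hs1⟩) hW₀
      (fun W hW ε hε => eventually_feasible_mix hP hd hf_nonneg hf_mono ht hDl hlt hlow hup
        hW₀ hW₀d hW hε)
    have hset := hleast
    rw [exponentMechanisms, image_setOf_mechanism] at hset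
    refine ⟨ℓ, hℓ, fun hnd => ?_, hset⟩
    have hset' : IsLeast {r | ∃ W : X × Y → Xh → ℝ, IsMechanism W ∧
        Rl d (jointX P W) Dl ≤ Ru d (jointX P W) Du ∧ r = mutualInfo (jointY P W)} ℓ := by
      convert hset using 1
      ext r
      exact exists_congr fun W => and_congr_right fun hW =>
        and_congr_left' (le_Ru_iff_of_ne hP hnd hW _)
    exact ⟨hset', isLeast_of_Rl_eq_Ru hP hset' (hL Du (hDl.1.trans hlu))⟩
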